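/- Let $k$ be an algebraically closed field of characteristic $0$, let $V=k^r$, $W=(k^\times)^s$ and $Y=V\times W$, and let the torus $G=(k^\times)^m$ act diagonally on $Y$ through characters $\eta_1,\dots,\eta_{r+s}$, that is, $g\in G$ multiplies the $j$-th coordinate by $\eta_j(g)$. For a smooth affine variety $X$ let $\mathcal D(X)$ denote the ring of differential operators on $X$; the action of a group on $X$ induces an action on $\mathcal D(X)$. Assume that $G$ acts transitively on $W$, let $w\in W$, and let $H$ be the stabilizer of $w$ in $G$; it acts on $V$ through $\eta_1,\dots,\eta_r$. Let $\mathfrak g=\mathrm{Lie}(G)$, let $\mathfrak h=\mathrm{Lie}(H)\subseteq\mathfrak g$, and let $i^*:\mathfrak g^*\to\mathfrak h^*$ be the restriction map dual to the inclusion. The differentials of the actions map $\mathfrak g$ to $\mathcal D(Y)^G$ and $\mathfrak h$ to $\mathcal D(V)^H$. For $\lambda\in\mathfrak g^*$ and $\mu\in\mathfrak h^*$ set $$\mathcal B_\lambda(Y)=\mathcal D(Y)^G/(\mathfrak g-\lambda(\mathfrak g)),\qquad \mathcal B_\mu(V)=\mathcal D(V)^H/(\mathfrak h-\mu(\mathfrak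 h)),$$ the quotients by the two-sided ideals generated by the elements $x-\lambda(x)$ with $x\in\mathfrak g$, respectively $x-\mu(x)$ with $x\in\mathfrak h$ (where $x$ also denotes its image among the differential operators). Then there is an injective homomorphism of $k$-algebras $\xi:\mathcal D(V)^H\to\mathcal D(Y)^G$ such that, for every $\lambda\in\mathfrak g^*$ and $\mu=i^*(\lambda)$, $\xi$ induces an isomorphism of $k$-algebras $\mathcal B_\mu(V)\cong\mathcal B_\lambda(Y)$. -/

import Mathlib

open scoped BigOperators

namespace TorusDiffOps

noncomputable section

/-! ### Differential operators on a commutative algebra -/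

section DiffOps

variable (k : Type*) {A : Type*} [CommRing k] [CommRing A] [Algebra k A]

/-- `IsDiffOpOfOrder k n D`: the `k`-linear endomorphism `D` of the commutative `k`-algebra `A` is a
differential operator of order at most `n` in the sense of Grothendieck, that is
`[...[[D, a₀], a₁], ..., aₙ] = 0` for all `a₀, ..., aₙ` in `A`, where an element of `A` is viewed as
the operator of multiplication by it. -/
def IsDiffOpOfOrder : ℕ → Module.End k A → Prop
  | 0, D => ∀ a : A, D * LinearMap.mulLeft k a - LinearMap.mulLeft k a * D = 0
  | n + 1, D => ∀ a : A, IsDiffOpOfOrder n (D * LinearMap.mulLeft k a - LinearMap.mulLeft k a * D)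

variable {k}

theorem IsDiffOpOfOrder.zero (n : ℕ) : IsDiffOpOfOrder k n (0 : Module.End k A) := by
  induction n with
  | zero => intro a; simp
  | succ n ih => intro a; simpa using ih

theorem IsDiffOpOfOrder.succ {n : ℕ} {D : Module.End k A} (h : IsDiffOpOfOrder k n D) :
    IsDiffOpOfOrder k (n + 1) D := by
  induction n generalizing D with
  | zero => intro a; rw [h a]; exact IsDiffOpOfOrder.zero 0
  | succ n ih => intro a; exact ih (h a)

theorem IsDiffOpOfOrder.mono {n m : ℕ} (hnm : n ≤ m) {D : Module.End k A}
    (h : IsDiffOpOfOrder k n D) : IsDiffOpOfOrder k m D := by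
  induction hnm with
  | refl => exact h
  | step _ ih => exact ih.succ

theorem IsDiffOpOfOrder.add {n : ℕ} {D E : Module.End k A} (hD : IsDiffOpOfOrder k n D)
    (hE : IsDiffOpOfOrder k n E) : IsDiffOpOfOrder k n (D + E) := by
  induction n generalizing D E with
  | zero =>
    intro a
    have h1 := hD a
    have h2 := hE a
    have : (D + E) * LinearMap.mulLeft k a - LinearMap.mulLeft k a * (D + E)
      = (D * LinearMap.mulLeft k a - LinearMap.mulLeft k a * D)
        + (E * LinearMap.mulLeft k a - LinearMap.mulLeft k a * E) := by noncomm_ring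
    rw [this, h1, h2, add_zero]
  | succ n ih =>
    intro a
    have : (D + E) * LinearMap.mulLeft k a - LinearMap.mulLeft k a * (D + E)
      = (D * LinearMap.mulLeft k a - LinearMap.mulLeft k a * D)
        + (E * LinearMap.mulLeft k a - LinearMap.mulLeft k a * E) := by noncomm_ring
    rw [this]
    exact ih (hD a) (hE a)

theorem commutator_mul (D E L : Module.End k A) :
    (D * E) * L - L * (D * E) = D * (E * L - L * E) + (D * L - L * D) * E := by
  simp only [mul_sub, sub_mul, mul_assoc]
  abel

theorem IsDiffOpOfOrder.mul : ∀ {N n m : ℕ}, n + m = N → ∀ {D E : Module.End k A},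
    IsDiffOpOfOrder k n D → IsDiffOpOfOrder k m E → IsDiffOpOfOrder k N (D * E) := by
  intro N
  induction N with
  | zero =>
    intro n m h D E hD hE a
    obtain rfl : n = 0 := by omega
    obtain rfl : m = 0 := by omega
    rw [commutator_mul, hE a, hD a, mul_zero, zero_mul, add_zero]
  | succ N ih =>
    intro n m h D E hD hE a
    rw [commutator_mul]
    refine IsDiffOpOfOrder.add ?_ ?_
    · cases m with
      | zero => rw [hE a, mul_zero]; exact IsDiffOpOfOrder.zero N
      | succ m => exact ih (by omega) hD (hE a)
    · cases n with
      | zero => rw [hD a, zero_mul]; exact IsDiffOpOfOrder.zero N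
      | succ n => exact ih (by omega) (hD a) hE

theorem IsDiffOpOfOrder.algebraMap (c : k) :
    IsDiffOpOfOrder k 0 (algebraMap k (Module.End k A) c) := by
  intro a
  rw [(Algebra.commutes c (LinearMap.mulLeft k a)), sub_self]

variable (k A) in
/-- The ring of differential operators of the commutative `k`-algebra `A`. -/
def diffOps : Subalgebra k (Module.End k A) where
  carrier := {D | ∃ n, IsDiffOpOfOrder k n D}
  mul_mem' := by
    rintro D E ⟨n, hD⟩ ⟨m, hE⟩
    exact ⟨n + m, hD.mul rfl hE⟩
  add_mem' := by
    rintro D E ⟨n, hD⟩ ⟨m, hE⟩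
    exact ⟨max n m, (hD.mono (le_max_left n m)).add (hE.mono (le_max_right n m))⟩
  algebraMap_mem' c := ⟨0, IsDiffOpOfOrder.algebraMap c⟩

/-- For an action `ρ` of a group `Γ` on the algebra `A` by algebra automorphisms and a subgroup `H`
of `Γ`, the ring of `H`-invariant differential operators of `A`: an element `g` acts on operators
by `D ↦ ρ g ∘ D ∘ (ρ g)⁻¹`. -/
def invDiffOps {Γ : Type*} [Group Γ] (ρ : Γ →* (A ≃ₐ[k] A)) (H : Subgroup Γ) :
    Subalgebra k (Module.End k A) where
  carrier := {D | D ∈ diffOps k A ∧ ∀ g ∈ H, (ρ g).toLinearEquiv.conj D = D}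
  mul_mem' := by
    rintro D E ⟨hD, hD'⟩ ⟨hE, hE'⟩
    refine ⟨mul_mem hD hE, fun g hg => ?_⟩
    change (ρ g).toLinearEquiv.conj (D ∘ₗ E) = D ∘ₗ E
    rw [LinearEquiv.conj_comp, hD' g hg, hE' g hg]
  add_mem' := by
    rintro D E ⟨hD, hD'⟩ ⟨hE, hE'⟩
    exact ⟨add_mem hD hE, fun g hg => by rw [map_add, hD' g hg, hE' g hg]⟩
  algebraMap_mem' c := by
    refine ⟨Subalgebra.algebraMap_mem _ c, fun g _ => ?_⟩
    ext x
    simp [LinearEquiv.conj_apply, Module.algebraMap_end_apply]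

end DiffOps

/-! ### Tori, their characters and the Lie algebras of their subgroups -/

section Torus

variable (k : Type*) [Field k]

/-- The group of `k`-points of the torus `(kˣ)ᵐ`. -/
abbrev Torus (m : ℕ) : Type _ := Fin m → kˣ

variable {k} {m : ℕ}

/-- The character `g ↦ g₁ ^ χ₁ ⋯ gₘ ^ χₘ` of the torus with exponent vector `χ`. -/
def character (χ : Fin m → ℤ) : Torus k m →* kˣ where
  toFun g := ∏ i, g i ^ χ i
  map_one' := by simp
  map_mul' g h := by simp [mul_zpow, Finset.prod_mul_distrib]

theorem character_add (χ ψ : Fin m → ℤ) (g : Torus k m) :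
    character (χ + ψ) g = character χ g * character ψ g := by
  simp [character, zpow_add, Finset.prod_mul_distrib]

theorem character_zero (g : Torus k m) : character (0 : Fin m → ℤ) g = 1 := by
  simp [character]

/-- The Lie algebra of (the Zariski closure of) a subgroup `H` of the torus `(kˣ)ᵐ`, as a subspace
of the Lie algebra `kᵐ` of the torus: the tangent space at the identity, that is the space of all
vectors `x` that are killed by the differential at the identity of every polynomial function
vanishing on `H`. -/
def lieAlg (H : Subgroup (Torus k m)) : Submodule k (Fin m → k) where
  carrier := {x | ∀ f : MvPolynomial (Fin m) k,
    (∀ g ∈ H, MvPolynomial.eval (fun i => (g i : k)) f = 0) →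
      ∑ i, x i * MvPolynomial.eval (fun _ => (1 : k)) (MvPolynomial.pderiv i f) = 0}
  add_mem' := by
    intro x y hx hy f hf
    simp only [Pi.add_apply, add_mul, Finset.sum_add_distrib, hx f hf, hy f hf, add_zero]
  zero_mem' := by
    intro f _
    simp
  smul_mem' := by
    intro c x hx f hf
    simp only [Pi.smul_apply, smul_eq_mul, mul_assoc, ← Finset.mul_sum, hx f hf, mul_zero]

theorem lieAlg_mono {H K : Subgroup (Torus k m)} (h : H ≤ K) : lieAlg H ≤ lieAlg K :=
  fun _ hx f hf => hx f fun g hg => hf g (h hg)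

/-- The map `i* : 𝔤* → 𝔥*` dual to the inclusion `i : 𝔥 → 𝔤`, where `𝔥 = Lie(H)` and `𝔤 = Lie(G)`
for the whole torus `G`. -/
def restrictDual (H : Subgroup (Torus k m))
    (lam : Module.Dual k (lieAlg (⊤ : Subgroup (Torus k m)))) : Module.Dual k (lieAlg H) :=
  lam.comp (Submodule.inclusion (lieAlg_mono le_top))

end Torus

/-! ### Torus actions on rings of (Laurent) polynomials -/

section Action

variable {k : Type*} [Field k] {m : ℕ} {M : Type*} [AddCommMonoid M]

/-- The automorphism by which the element `g` of the torus acts on the algebra `k[M]` with basis the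
monomials `Q ^ α`, `α ∈ M`, where `Q ^ α` has weight `wt α`. -/
def torusActHom (wt : M →+ (Fin m → ℤ)) (g : Torus k m) :
    AddMonoidAlgebra k M →ₐ[k] AddMonoidAlgebra k M :=
  AddMonoidAlgebra.lift k _ M
    { toFun := fun α => AddMonoidAlgebra.single α.toAdd (character (wt α.toAdd) g : k)
      map_one' := by
        simp [character_zero, AddMonoidAlgebra.one_def]
      map_mul' := fun α β => by
        simp [character_add, AddMonoidAlgebra.single_mul_single] }

theorem torusActHom_single (wt : M →+ (Fin m → ℤ)) (g : Torus k m) (α : M) (c : k) :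
    torusActHom wt g (AddMonoidAlgebra.single α c)
      = AddMonoidAlgebra.single α (c * (character (wt α) g : k)) := by
  simp [torusActHom, AddMonoidAlgebra.lift_single]

theorem torusActHom_comp (wt : M →+ (Fin m → ℤ)) (g h : Torus k m) :
    (torusActHom wt g).comp (torusActHom wt h) = torusActHom wt (g * h) := by
  refine AddMonoidAlgebra.algHom_ext (fun α => ?_) (by ext)
  simp [torusActHom_single, map_mul, mul_comm]

theorem torusActHom_one (wt : M →+ (Fin m → ℤ)) :
    torusActHom wt (1 : Torus k m) = AlgHom.id k _ := by
  refine AddMonoidAlgebra.algHom_ext (fun α => ?_) (by ext)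
  simp [torusActHom_single]

/-- The action of the torus on `k[M]` in which the monomial `Q ^ α` has weight `wt α`. -/
def torusAct (wt : M →+ (Fin m → ℤ)) :
    Torus k m →* (AddMonoidAlgebra k M ≃ₐ[k] AddMonoidAlgebra k M) where
  toFun g := AlgEquiv.ofAlgHom (torusActHom wt g) (torusActHom wt g⁻¹)
    (by rw [torusActHom_comp, mul_inv_cancel, torusActHom_one])
    (by rw [torusActHom_comp, inv_mul_cancel, torusActHom_one])
  map_one' := by
    ext1 x
    exact congrArg (fun φ => φ x) (torusActHom_one (k := k) wt)
  map_mul' g h := by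
    ext1 x
    exact congrArg (fun φ => φ x) (torusActHom_comp wt g h).symm

/-- The differential of the action of the torus on `k[M]`: the element `x` of the Lie algebra `kᵐ` of
the torus acts by the derivation `Q ^ α ↦ (∑ i, xᵢ (wt α)ᵢ) Q ^ α`. If the weight of the coordinate
function `Q_j` is `η_j`, this derivation is `∑ j, (∑ i, xᵢ (η_j)ᵢ) Q_j ∂/∂Q_j`. -/
def lieOp (wt : M →+ (Fin m → ℤ)) (x : Fin m → k) : Module.End k (AddMonoidAlgebra k M) :=
  (Finsupp.linearCombination k
      (fun α : M => AddMonoidAlgebra.single α (∑ i, x i * ((wt α i : ℤ) : k)))).comp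
    (AddMonoidAlgebra.coeffLinearEquiv k).toLinearMap

theorem lieOp_single (wt : M →+ (Fin m → ℤ)) (x : Fin m → k) (α : M) (c : k) :
    lieOp wt x (AddMonoidAlgebra.single α c)
      = AddMonoidAlgebra.single α (c * ∑ i, x i * ((wt α i : ℤ) : k)) := by
  simp [lieOp, Finsupp.linearCombination_single]

theorem lieOp_mul (wt : M →+ (Fin m → ℤ)) (x : Fin m → k) (a b : AddMonoidAlgebra k M) :
    lieOp wt x (a * b) = lieOp wt x a * b + a * lieOp wt x b := by
  induction a using AddMonoidAlgebra.induction_linear with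
  | zero => simp
  | add a a' ha ha' => rw [add_mul, map_add, map_add, ha, ha']; ring
  | single α c =>
    induction b using AddMonoidAlgebra.induction_linear with
    | zero => simp
    | add b b' hb hb' => rw [mul_add, map_add, map_add, hb, hb']; ring
    | single β d =>
      simp only [AddMonoidAlgebra.single_mul_single, lieOp_single, ← AddMonoidAlgebra.single_add,
        map_add, Pi.add_apply, Int.cast_add, mul_add, Finset.sum_add_distrib]
      congr 1
      ring

/-- Elements of the Lie algebra act on `k[M]` by torus-invariant differential operators. -/
theorem lieOp_mem (wt : M →+ (Fin m → ℤ)) (H : Subgroup (Torus k m)) (x : Fin m → k) :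
    lieOp wt x ∈ invDiffOps (torusAct wt) H := by
  refine ⟨⟨1, fun a b => ?_⟩, fun g _ => ?_⟩
  · have h : lieOp wt x * LinearMap.mulLeft k a - LinearMap.mulLeft k a * lieOp wt x
        = LinearMap.mulLeft k (lieOp wt x a) := by
      refine LinearMap.ext fun c => ?_
      simp [lieOp_mul]
    rw [h]
    refine LinearMap.ext fun c => ?_
    simp [mul_left_comm]
  · refine LinearMap.ext fun a => ?_
    have h : ∀ b, torusAct wt g (lieOp wt x b) = lieOp wt x (torusAct wt g b) := by
      intro b
      induction b using AddMonoidAlgebra.induction_linear with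
      | zero => simp
      | add b b' hb hb' => simp only [map_add, hb, hb']
      | single β d =>
        change torusActHom wt g _ = lieOp wt x (torusActHom wt g _)
        rw [lieOp_single, torusActHom_single, torusActHom_single, lieOp_single]
        congr 1
        ring
    change torusAct wt g (lieOp wt x ((torusAct wt g).symm a)) = lieOp wt x a
    rw [h, AlgEquiv.apply_symm_apply]

/-- The relation `x = μ(x)`, `x ∈ 𝔥 = Lie(H)`, on the algebra of `H`-invariant differential
operators of `k[M]`. -/
def lieRel (wt : M →+ (Fin m → ℤ)) (H : Subgroup (Torus k m)) (μ : Module.Dual k (lieAlg H))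
    (a b : invDiffOps (torusAct (k := k) wt) H) : Prop :=
  ∃ x : lieAlg H, a = ⟨lieOp wt (x : Fin m → k), lieOp_mem wt H x⟩ ∧
    b = algebraMap k (invDiffOps (torusAct (k := k) wt) H) (μ x)

/-- The quotient of the algebra of `H`-invariant differential operators of `k[M]` by the two-sided
ideal generated by all the elements `x - μ(x)`, `x ∈ 𝔥 = Lie(H)`. -/
abbrev Reduction (wt : M →+ (Fin m → ℤ)) (H : Subgroup (Torus k m))
    (μ : Module.Dual k (lieAlg H)) : Type _ :=
  RingQuot (lieRel wt H μ)

/-- The quotient map onto the reduction. -/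
abbrev Reduction.mk (wt : M →+ (Fin m → ℤ)) (H : Subgroup (Torus k m))
    (μ : Module.Dual k (lieAlg H)) :
    invDiffOps (torusAct (k := k) wt) H →ₐ[k] Reduction wt H μ :=
  RingQuot.mkAlgHom k (lieRel wt H μ)

end Action

/-! ### The diagonal action on `Y = V × W`, with `V = k ^ r` and `W = (kˣ) ^ s`

The torus `G = (kˣ)ᵐ` acts on `Y` by an integer matrix `L` with `m` rows whose columns, indexed by
`Fin r ⊕ Fin s`, are the weights `η_j` of the coordinate functions `Q_j`:
an element `g` multiplies the `j`-th coordinate by `η_j(g)`. The ring of regular functions on `V` is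
`𝒪(V) = k[Q₁, ..., Q_r] = k[ℕ ^ r]`, and that on `Y` is
`𝒪(Y) = k[Q₁, ..., Q_r, Q_{r+1}^{±1}, ..., Q_{r+s}^{±1}] = k[ℕ ^ r × ℤ ^ s]`. -/

section Diagonal

variable {m r s : ℕ}

/-- The weight `∑ j, α_j η_j` of the monomial `Q ^ α` in `𝒪(V)`. -/
def weightV (L : Matrix (Fin m) (Fin r ⊕ Fin s) ℤ) : (Fin r → ℕ) →+ (Fin m → ℤ) where
  toFun α := fun i => ∑ j, L i (Sum.inl j) * (α j : ℤ)
  map_zero' := by ext i; simp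
  map_add' α β := by ext i; simp [mul_add, Finset.sum_add_distrib]

/-- The weight `∑ j, α_j η_j + ∑ j, β_j η_{r+j}` of the monomial `Q ^ (α, β)` in `𝒪(Y)`. -/
def weightY (L : Matrix (Fin m) (Fin r ⊕ Fin s) ℤ) :
    (Fin r → ℕ) × (Fin s → ℤ) →+ (Fin m → ℤ) where
  toFun α := fun i => ∑ j, L i (Sum.inl j) * (α.1 j : ℤ) + ∑ j, L i (Sum.inr j) * α.2 j
  map_zero' := by ext i; simp
  map_add' α β := by ext i; simp [mul_add, Finset.sum_add_distrib]; ring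

variable {k : Type*} [Field k]

/-- The action of the torus on the points of `W = (kˣ) ^ s`. -/
def actW (L : Matrix (Fin m) (Fin r ⊕ Fin s) ℤ) (g : Torus k m) (w : Fin s → kˣ) : Fin s → kˣ :=
  fun j => character (fun i => L i (Sum.inr j)) g * w j

/-- The torus acts transitively on `W`. -/
def IsTransitiveOnW (k : Type*) [Field k] (L : Matrix (Fin m) (Fin r ⊕ Fin s) ℤ) : Prop :=
  ∀ w w' : Fin s → kˣ, ∃ g : Torus k m, actW L g w = w'

/-- The stabilizer in the torus of a point `w` of `W`. -/
def stabW (L : Matrix (Fin m) (Fin r ⊕ Fin s) ℤ) (w : Fin s → kˣ) : Subgroup (Torus k m) where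
  carrier := {g | actW L g w = w}
  one_mem' := by
    change actW L 1 w = w
    ext j
    simp [actW]
  mul_mem' := by
    intro g h hg hh
    change actW L (g * h) w = w
    change actW L g w = w at hg
    change actW L h w = w at hh
    simp only [actW, funext_iff, mul_eq_right, map_mul] at hg hh ⊢
    intro j
    rw [hg j, hh j, one_mul]
  inv_mem' := by
    intro g hg
    change actW L g⁻¹ w = w
    change actW L g w = w at hg
    simp only [actW, funext_iff, mul_eq_right, map_inv, inv_eq_one] at hg ⊢
    exact hg

/-- The algebra `𝒟(V)^H` for a subgroup `H` of the torus. -/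
abbrev invDiffOpsV (L : Matrix (Fin m) (Fin r ⊕ Fin s) ℤ) (H : Subgroup (Torus k m)) :
    Subalgebra k (Module.End k (AddMonoidAlgebra k (Fin r → ℕ))) :=
  invDiffOps (torusAct (weightV L)) H

/-- The algebra `𝒟(Y)^G`, for the whole torus `G`. -/
abbrev invDiffOpsY (k : Type*) [Field k] (L : Matrix (Fin m) (Fin r ⊕ Fin s) ℤ) :
    Subalgebra k (Module.End k (AddMonoidAlgebra k ((Fin r → ℕ) × (Fin s → ℤ)))) :=
  invDiffOps (torusAct (weightY L)) (⊤ : Subgroup (Torus k m))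

end Diagonal

end

end TorusDiffOps

namespace TorusDiffOps

noncomputable section

/-! ### Characters of the torus and the stabilizer of a point of `W` -/

section Characters

variable {k : Type*} [Field k] {m r s : ℕ}

/-! Write Λ for the lattice spanned by the weights of the coordinates of W. Transitivity makes these
weights linearly independent (`weightW_injective`), and Λ is exactly the lattice of characters
trivial on H (`character_eq_one_iff`). An operator on V is therefore H-invariant when it changes
weights by elements of Λ, and an operator on Y is G-invariant when it preserves weights
(`conj_torusAct_eq_iff`). Everything below is expressed in these terms.

Geometrically Y = G ×_H V: restriction to V × {1} identifies the functions of weight χ on Y with the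
functions on V whose weights lie in χ + Λ. An H-invariant D preserves the latter space, so it
transports to an operator ξ(D) on each weight space of Y, hence on all functions on Y; this is
`liftHom`. It is a differential operator because its commutators with monomials are again lifts of
commutators of D (`commutator_liftOp`).

Choose X_1, ..., X_s in 𝔤 dual to the weights of W (`exists_dual_weights`). They act by central
operators, and 𝒟(Y)^G is the polynomial algebra over ξ(𝒟(V)^H) in them. Generation
(`invDiffOpsY_le`) is by induction on the coordinates of W with which an operator need not commute:
the commutator with one coordinate lowers the order, and it is integrated by solving P(t + 1) - P(t)
= p(t). Independence (`polyHom_injective`) holds since a polynomial vanishing on a product of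
infinite sets is zero.

Finally 𝔥 is the annihilator of Λ (`mem_lieAlg_stabW`), so 𝔤 is the direct sum of 𝔥 and the span of
the X_j. Setting X_j = λ(X_j) retracts 𝒟(Y)^G onto 𝒟(V)^H. The relations that remain are those of 𝔥,
because ξ carries the action of 𝔥 on V to its action on Y (`exists_reduction_equiv`). -/

/-- The characters with values in the units of `k` separate the points of an abelian group. -/
theorem exists_linearMap_units_ne_zero [IsAlgClosed k] [CharZero k] {Q : Type*}
    [AddCommGroup Q] {x : Q} (hx : x ≠ 0) : ∃ f : Q →ₗ[ℤ] Additive kˣ, f x ≠ 0 := by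
  have hd : addOrderOf x ≠ 1 := fun h => hx (AddMonoid.addOrderOf_eq_one_iff.mp h)
  -- The order is 0 for an element of infinite order and then every prime divides it, so both cases
  -- are handled together. Sending x to a primitive p-th root of unity is well defined on the
  -- subgroup generated by x.
  obtain ⟨p, hp, hpd⟩ := Nat.exists_prime_and_dvd hd
  have : NeZero p := ⟨hp.ne_zero⟩
  have : NeZero (p : k) := ⟨Nat.cast_ne_zero.mpr hp.ne_zero⟩
  obtain ⟨ζ, hζ⟩ := HasEnoughRootsOfUnity.exists_primitiveRoot k p
  let z : kˣ := (hζ.isUnit hp.ne_zero).unit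
  have hz1 : z ≠ 1 := fun h => hζ.ne_one hp.one_lt (congrArg Units.val h)
  have hzp : z ^ p = 1 := Units.ext (by simpa [z] using hζ.pow_eq_one)
  have H : ∀ c : ℤ, c • x = 0 → c • Additive.ofMul z = 0 := by
    intro c hc
    obtain ⟨e, rfl⟩ : (p : ℤ) ∣ c :=
      (Int.natCast_dvd_natCast.mpr hpd).trans (addOrderOf_dvd_iff_zsmul_eq_zero.mpr hc)
    rw [← ofMul_zpow, zpow_mul, zpow_natCast, hzp, one_zpow, ofMul_one]
  -- Over an algebraically closed field kˣ is divisible, hence an injective abelian group by Baer's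
  -- criterion; the character of the cyclic subgroup extends.
  let _ : DivisibleBy (Additive kˣ) ℕ := divisibleByOfSMulRightSurj _ _ fun {n} hn a => by
    obtain ⟨b, hb⟩ := IsAlgClosed.exists_pow_nat_eq ((a.toMul : kˣ) : k) (Nat.pos_of_ne_zero hn)
    have hb0 : b ≠ 0 := by
      rintro rfl
      rw [zero_pow hn] at hb
      exact a.toMul.ne_zero hb.symm
    refine ⟨Additive.ofMul (Units.mk0 b hb0), ?_⟩
    change Additive.ofMul (Units.mk0 b hb0 ^ n) = a
    exact congrArg Additive.ofMul (a₂ := a.toMul) (Units.ext (by simpa using hb))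
  let _ : DivisibleBy (Additive kˣ) ℤ := AddGroup.divisibleByIntOfDivisibleByNat _
  let f := LinearPMap.mkSpanSingleton' (σ := RingHom.id ℤ) x (Additive.ofMul z) H
  obtain ⟨g, hg⟩ := (Module.Baer.of_divisible (Additive kˣ)).extension_property
    f.domain.subtype f.domain.injective_subtype f.toFun
  refine ⟨g, fun h0 => hz1 ?_⟩
  have hxm : x ∈ f.domain := Submodule.mem_span_singleton_self x
  have h1 : g x = f ⟨x, hxm⟩ := LinearMap.congr_fun hg ⟨x, hxm⟩
  have h2 : f ⟨x, hxm⟩ = Additive.ofMul z :=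
    LinearPMap.mkSpanSingleton'_apply_self (σ := RingHom.id ℤ) x (Additive.ofMul z) H hxm
  rw [h0, h2] at h1
  exact congrArg Additive.toMul h1.symm

/-- A sublattice of the character lattice of a torus is cut out by the points that it kills. -/
theorem exists_torus_of_not_mem [IsAlgClosed k] [CharZero k] (Λ : AddSubgroup (Fin m → ℤ))
    {χ : Fin m → ℤ} (hχ : χ ∉ Λ) :
    ∃ g : Torus k m, (∀ ψ ∈ Λ, character ψ g = 1) ∧ character χ g ≠ 1 := by
  obtain ⟨f, hf⟩ := exists_linearMap_units_ne_zero (k := k) (x := QuotientAddGroup.mk' Λ χ)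
    (fun h => hχ ((QuotientAddGroup.eq_zero_iff χ).mp h))
  -- A homomorphism from the character lattice to kˣ is evaluation at the point whose coordinates
  -- are the images of the standard basis.
  have key : ∀ ψ : Fin m → ℤ,
      character ψ (fun i => (f (QuotientAddGroup.mk' Λ (Pi.single i 1))).toMul)
        = (f (QuotientAddGroup.mk' Λ ψ)).toMul := by
    intro ψ
    have hψ : ψ = ∑ i, ψ i • (Pi.single i 1 : Fin m → ℤ) := pi_eq_sum_univ' ψ
    conv_rhs => rw [hψ]
    simp [character, map_sum, toMul_sum]
  refine ⟨fun i => (f (QuotientAddGroup.mk' Λ (Pi.single i 1))).toMul, fun ψ hψ => ?_, ?_⟩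
  · rw [key, show QuotientAddGroup.mk' Λ ψ = 0 from (QuotientAddGroup.eq_zero_iff ψ).mpr hψ,
      map_zero, toMul_zero]
  · rw [key]
    exact fun h => hf (congrArg Additive.ofMul h)

theorem character_neg (χ : Fin m → ℤ) (g : Torus k m) : character (-χ) g = (character χ g)⁻¹ := by
  simp [character]

theorem character_sub (χ ψ : Fin m → ℤ) (g : Torus k m) :
    character (χ - ψ) g = character χ g / character ψ g := by
  rw [sub_eq_add_neg, character_add, character_neg, div_eq_mul_inv]

theorem eq_of_character_eq [IsAlgClosed k] [CharZero k] {χ ψ : Fin m → ℤ}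
    (h : ∀ g : Torus k m, character χ g = character ψ g) : χ = ψ := by
  by_contra hne
  obtain ⟨g, -, hg⟩ := exists_torus_of_not_mem (k := k) (⊥ : AddSubgroup (Fin m → ℤ))
    (χ := χ - ψ) (by simpa [sub_eq_zero] using hne)
  exact hg (by rw [character_sub, h g, div_self'])

/-- The weight `∑ j, β_j η_{r+j}` of the monomial `Q ^ β` in `𝒪(W)`. -/
def weightW (L : Matrix (Fin m) (Fin r ⊕ Fin s) ℤ) : (Fin s → ℤ) →+ (Fin m → ℤ) :=
  (weightY L).comp (AddMonoidHom.inr _ _)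

theorem weightW_apply (L : Matrix (Fin m) (Fin r ⊕ Fin s) ℤ) (β : Fin s → ℤ) (i : Fin m) :
    weightW L β i = ∑ j, L i (Sum.inr j) * β j := by
  simp [weightW, weightY]

theorem weightY_apply (L : Matrix (Fin m) (Fin r ⊕ Fin s) ℤ) (α : Fin r → ℕ) (β : Fin s → ℤ) :
    weightY L (α, β) = weightV L α + weightW L β := by
  ext i
  rw [Pi.add_apply, weightW_apply]
  rfl

theorem weightW_single (L : Matrix (Fin m) (Fin r ⊕ Fin s) ℤ) (j : Fin s) :
    weightW L (Pi.single j 1) = fun i => L i (Sum.inr j) := by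
  ext i
  simp [weightW_apply, Pi.single_apply]

theorem character_weightW (L : Matrix (Fin m) (Fin r ⊕ Fin s) ℤ) (β : Fin s → ℤ)
    (g : Torus k m) :
    character (weightW L β) g = ∏ j, character (fun i => L i (Sum.inr j)) g ^ β j := by
  simp only [character, MonoidHom.coe_mk, OneHom.coe_mk, weightW_apply, ← Finset.prod_zpow]
  rw [Finset.prod_comm]
  refine Finset.prod_congr rfl fun i _ => ?_
  simp only [← zpow_mul]
  exact map_prod (zpowersHom kˣ (g i))
    (fun j => Multiplicative.ofAdd (L i (Sum.inr j) * β j)) Finset.univ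

theorem mem_stabW {L : Matrix (Fin m) (Fin r ⊕ Fin s) ℤ} {w : Fin s → kˣ} {g : Torus k m} :
    g ∈ stabW L w ↔ ∀ j, character (fun i => L i (Sum.inr j)) g = 1 := by
  change actW L g w = w ↔ _
  simp [actW, funext_iff]

/-- The stabilizer is the common kernel of the weights of W, and a sublattice is recovered from the
points it kills. The lattice need not be saturated, so the stabilizer may be disconnected. -/
theorem character_eq_one_iff [IsAlgClosed k] [CharZero k] (L : Matrix (Fin m) (Fin r ⊕ Fin s) ℤ)
    (w : Fin s → kˣ) (χ : Fin m → ℤ) :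
    (∀ g ∈ stabW L w, character χ g = 1) ↔ χ ∈ (weightW L).range := by
  constructor
  · intro h
    by_contra hχ
    obtain ⟨g, hg, hg'⟩ := exists_torus_of_not_mem (k := k) _ hχ
    refine hg' (h g (mem_stabW.mpr fun j => ?_))
    rw [← weightW_single]
    exact hg _ ⟨_, rfl⟩
  · rintro ⟨β, rfl⟩ g hg
    rw [character_weightW]
    exact Finset.prod_eq_one fun j _ => by rw [mem_stabW.mp hg j, one_zpow]

/-- A relation β among the weights of W forces ∏ w_j ^ β_j = 1 on the orbit of 1. Transitivity puts
in this orbit the point with j-th coordinate 2 and all others 1, and 2 ^ β_j = 1 gives β_j = 0 in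
characteristic 0. -/
theorem weightW_injective [CharZero k] {L : Matrix (Fin m) (Fin r ⊕ Fin s) ℤ}
    (hL : IsTransitiveOnW k L) : Function.Injective (weightW L) := by
  rw [injective_iff_map_eq_zero]
  intro β hβ
  ext j
  have h2 : (2 : k) ≠ 0 := two_ne_zero
  obtain ⟨g, hg⟩ := hL 1 (Pi.mulSingle j (Units.mk0 2 h2))
  have h1 := character_weightW L β g
  rw [hβ, character_zero, Finset.prod_eq_single j] at h1
  · have h3 := congrFun hg j
    simp only [actW, Pi.one_apply, mul_one, Pi.mulSingle_eq_same] at h3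
    rw [h3] at h1
    have h4 : ((2 : ℚ) : k) ^ β j = ((1 : ℚ) : k) := by
      have := congrArg Units.val h1
      simpa using this.symm
    rw [← Rat.cast_zpow, Rat.cast_inj] at h4
    simpa using (zpow_eq_one_iff_right₀ (by norm_num) (by norm_num)).mp h4
  · intro l _ hl
    have h3 := congrFun hg l
    simp only [actW, Pi.one_apply, mul_one, Pi.mulSingle_eq_of_ne hl] at h3
    rw [h3, one_zpow]
  · simp

/-- The weights of the coordinates of `W` have a dual system in the Lie algebra of the torus. -/
theorem exists_dual_weights [CharZero k] {L : Matrix (Fin m) (Fin r ⊕ Fin s) ℤ}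
    (hL : Function.Injective (weightW L)) :
    ∃ X : Fin s → Fin m → k,
      ∀ j β, ∑ i, X j i * ((weightW L β i : ℤ) : k) = ((β j : ℤ) : k) := by
  have h1 : LinearIndependent ℤ (fun j i => L i (Sum.inr j) : Fin s → Fin m → ℤ) := by
    rw [Fintype.linearIndependent_iff]
    intro β hβ
    refine fun j => congrFun (hL (a₁ := β) (a₂ := 0) ?_) j
    rw [map_zero, ← hβ]
    ext i
    simp [weightW_apply, mul_comm]
  have h2 : LinearIndependent ℚ (fun j i => (L i (Sum.inr j) : ℚ) : Fin s → Fin m → ℚ) := by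
    rw [← LinearIndependent.iff_fractionRing (R := ℤ)]
    exact h1.map' (LinearMap.compLeft (Algebra.linearMap ℤ ℚ) (Fin m))
      (LinearMap.ker_eq_bot.mpr fun x y h => by
        ext i
        exact Int.cast_injective (α := ℚ) (congrFun h i))
  -- The weights stay independent over ℚ, so their matrix has a rational left inverse; its entries,
  -- mapped to k, are the coordinates of the dual system.
  obtain ⟨f, hf⟩ := LinearMap.exists_leftInverse_of_injective _
    (LinearMap.ker_eq_bot.mpr (linearIndependent_iff_injective_fintypeLinearCombination.mp h2))
  have key : ∀ (β : Fin s → ℤ), f (fun i => ((weightW L β i : ℤ) : ℚ)) = fun j => (β j : ℚ) := by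
    intro β
    have := LinearMap.congr_fun hf (fun j => (β j : ℚ))
    rw [LinearMap.id_apply] at this
    rw [← this, LinearMap.comp_apply]
    congr 1
    ext i
    simp [Fintype.linearCombination_apply, weightW_apply, mul_comm]
  refine ⟨fun j i => ((f (Pi.single i 1) j : ℚ) : k), fun j β => ?_⟩
  have h3 := congrFun (key β) j
  rw [pi_eq_sum_univ' (fun i => ((weightW L β i : ℤ) : ℚ)), map_sum, Finset.sum_apply] at h3
  have h4 := congrArg (fun q : ℚ => (q : k)) h3
  simpa [mul_comm] using h4

end Characters

/-! ### The Lie algebra of the stabilizer -/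

section LieAlgebra

variable {k : Type*} [Field k] {m r s : ℕ}

/-- The differential at the identity of the character with exponent vector `χ`, evaluated at the
element `x` of the Lie algebra of the torus. -/
def diffCharacter (x : Fin m → k) : (Fin m → ℤ) →+ k where
  toFun χ := ∑ i, x i * ((χ i : ℤ) : k)
  map_zero' := by simp
  map_add' χ ψ := by simp [mul_add, Finset.sum_add_distrib]

theorem diffCharacter_apply (x : Fin m → k) (χ : Fin m → ℤ) :
    diffCharacter x χ = ∑ i, x i * ((χ i : ℤ) : k) := rfl

theorem eval_torus (f : MvPolynomial (Fin m) k) (g : Torus k m) :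
    MvPolynomial.eval (fun i => (g i : k)) f
      = ∑ d ∈ f.support, f.coeff d * (character (fun i => (d i : ℤ)) g : k) := by
  rw [MvPolynomial.eval_eq']
  simp [character]

/-- Companion of `eval_torus`: a polynomial is a combination of characters, and its differential at
the identity is the same combination of their differentials. -/
theorem sum_eval_one_pderiv (f : MvPolynomial (Fin m) k) (x : Fin m → k) :
    ∑ i, x i * MvPolynomial.eval (fun _ => (1 : k)) (MvPolynomial.pderiv i f)
      = ∑ d ∈ f.support, f.coeff d * diffCharacter x (fun i => (d i : ℤ)) := by
  have h : ∀ i, MvPolynomial.eval (fun _ => (1 : k)) (MvPolynomial.pderiv i f)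
      = ∑ d ∈ f.support, f.coeff d * (d i : k) := by
    intro i
    conv_lhs => rw [← MvPolynomial.support_sum_monomial_coeff f, map_sum, map_sum]
    refine Finset.sum_congr rfl fun d _ => ?_
    simp [MvPolynomial.pderiv_monomial, MvPolynomial.eval_monomial]
  simp only [h, diffCharacter_apply, Finset.mul_sum]
  rw [Finset.sum_comm]
  refine Finset.sum_congr rfl fun d _ => Finset.sum_congr rfl fun i _ => ?_
  push_cast
  ring

/-- The torus is Zariski dense in affine space, so only the zero polynomial imposes a condition. -/
theorem mem_lieAlg_top [CharZero k] (x : Fin m → k) : x ∈ lieAlg (⊤ : Subgroup (Torus k m)) := by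
  intro f hf
  have hf0 : f = 0 := by
    refine MvPolynomial.funext_set (fun _ => {0}ᶜ) (fun _ => Set.Finite.infinite_compl
      (Set.finite_singleton 0)) fun y hy => ?_
    have hy' : ∀ i, y i ≠ 0 := fun i => hy i trivial
    rw [map_zero]
    exact hf (fun i => Units.mk0 (y i) (hy' i)) trivial
  simp [hf0]

theorem diffCharacter_eq_zero_of_mem_lieAlg {H : Subgroup (Torus k m)} {x : Fin m → k}
    (hx : x ∈ lieAlg H) {χ : Fin m → ℤ} (hχ : ∀ g ∈ H, character χ g = 1) :
    diffCharacter x χ = 0 := by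
  classical
  -- Polynomials have no negative exponents, so χ is split as a - b with a and b nonnegative; the
  -- binomial with exponents a and b vanishes on H.
  let a : Fin m →₀ ℕ := Finsupp.equivFunOnFinite.symm fun i => (χ i).toNat
  let b : Fin m →₀ ℕ := Finsupp.equivFunOnFinite.symm fun i => (-χ i).toNat
  have hab : (fun i => (a i : ℤ)) = χ + fun i => (b i : ℤ) := by
    ext i
    simp only [a, b, Finsupp.equivFunOnFinite_symm_apply_apply, Pi.add_apply]
    omega
  have h := hx (MvPolynomial.monomial a 1 - MvPolynomial.monomial b 1) fun g hg => by
    have h1 : character (fun i => (a i : ℤ)) g = character (fun i => (b i : ℤ)) g := by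
      rw [hab, character_add, hχ g hg, one_mul]
    have h2 := congrArg Units.val h1
    simp only [character, MonoidHom.coe_mk, OneHom.coe_mk, zpow_natCast, Units.coe_prod,
      Units.val_pow_eq_pow_val] at h2
    simp [MvPolynomial.eval_monomial, Finsupp.prod_fintype, h2]
  have h3 : ∑ i, x i * ((a i : k) - (b i : k)) = 0 := by
    rw [← h]
    refine Finset.sum_congr rfl fun i _ => ?_
    simp [MvPolynomial.pderiv_monomial, MvPolynomial.eval_monomial]
  rw [← h3, diffCharacter_apply]
  refine Finset.sum_congr rfl fun i _ => ?_
  have h4 := congrArg (fun n : ℤ => (n : k)) (congrFun hab i)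
  simp only [Pi.add_apply, Int.cast_add, Int.cast_natCast] at h4
  rw [h4, add_sub_cancel_right]

/-- For the converse, the monomials of a polynomial vanishing on H are grouped by their restriction
to H. Distinct characters of H are linearly independent, so the coefficients of each group sum to
zero; and x takes one value on each group because it kills Λ. -/
theorem mem_lieAlg_stabW [IsAlgClosed k] [CharZero k] {L : Matrix (Fin m) (Fin r ⊕ Fin s) ℤ}
    {w : Fin s → kˣ} {x : Fin m → k} :
    x ∈ lieAlg (stabW L w) ↔ ∀ β, diffCharacter x (weightW L β) = 0 := by
  refine ⟨fun hx β => diffCharacter_eq_zero_of_mem_lieAlg hx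
    ((character_eq_one_iff L w _).mpr ⟨β, rfl⟩), fun hx f hf => ?_⟩
  let v : (Fin m → ℤ) → (stabW L w →* k) := fun χ =>
    (Units.coeHom k).comp ((character χ).comp (stabW L w).subtype)
  have hv : (diffCharacter x : (Fin m → ℤ) → k).FactorsThrough v := by
    intro χ ψ h
    obtain ⟨β, hβ⟩ := (character_eq_one_iff L w (χ - ψ)).mp fun g hg => by
      have h1 : character χ g = character ψ g :=
        Units.ext (DFunLike.congr_fun h (⟨g, hg⟩ : stabW L w))
      rw [character_sub, h1, div_self']
    rw [← sub_eq_zero, ← map_sub, ← hβ, hx]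
  let l : (stabW L w →* k) →₀ k :=
    ∑ d ∈ f.support, Finsupp.single (v fun i => (d i : ℤ)) (f.coeff d)
  have hl : l = 0 := by
    refine linearIndependent_iff.mp (linearIndependent_monoidHom (stabW L w) k) l ?_
    ext g
    have h1 := hf g g.2
    rw [eval_torus] at h1
    simpa [l, map_sum, v] using h1
  -- The differential descends to restrictions of characters to H; the default value 0 of the
  -- extension is never met.
  have h2 := congrArg (Finsupp.linearCombination k (Function.extend v (diffCharacter x) 0)) hl
  rw [sum_eval_one_pderiv]
  simpa [l, map_sum, hv.extend_apply] using h2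

end LieAlgebra

/-! ### Linear maps on monoid algebras -/

section MonoidAlgebraMaps

variable {k : Type*} [Field k] {M : Type*}

/-- The linear map on `k[M]` with prescribed values at the monomials. -/
def monomialLift {N : Type*} [AddCommGroup N] [Module k N] (f : M → N) :
    AddMonoidAlgebra k M →ₗ[k] N :=
  (Finsupp.linearCombination k f).comp (AddMonoidAlgebra.coeffLinearEquiv k).toLinearMap

theorem monomialLift_single {N : Type*} [AddCommGroup N] [Module k N] (f : M → N) (α : M) (c : k) :
    monomialLift f (AddMonoidAlgebra.single α c) = c • f α := by
  simp [monomialLift, Finsupp.linearCombination_single]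

theorem single_eq_smul (α : M) (c : k) :
    AddMonoidAlgebra.single α c = c • AddMonoidAlgebra.single α (1 : k) := by
  simp

theorem linearMap_ext_single {N : Type*} [AddCommGroup N] [Module k N]
    {f g : AddMonoidAlgebra k M →ₗ[k] N}
    (h : ∀ α, f (AddMonoidAlgebra.single α 1) = g (AddMonoidAlgebra.single α 1)) : f = g := by
  ext α
  simpa using h α

theorem linearMap_eq_of_coeff {N : Type*} [AddCommGroup N] [Module k N]
    (f g : AddMonoidAlgebra k M →ₗ[k] N) (b : AddMonoidAlgebra k M)
    (h : ∀ α, b.coeff α ≠ 0 → f (AddMonoidAlgebra.single α 1) = g (AddMonoidAlgebra.single α 1)) :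
    f b = g b := by
  rw [← b.sum_coeff_single, Finsupp.sum, map_sum, map_sum]
  refine Finset.sum_congr rfl fun α hα => ?_
  rw [single_eq_smul, map_smul, map_smul, h α (Finsupp.mem_support_iff.mp hα)]

/-- The coefficient of a monomial, as a linear form. -/
def coeffForm (k : Type*) [Field k] {M : Type*} (α : M) : AddMonoidAlgebra k M →ₗ[k] k :=
  (Finsupp.lapply α).comp (AddMonoidAlgebra.coeffLinearEquiv k).toLinearMap

theorem coeffForm_apply (α : M) (b : AddMonoidAlgebra k M) : coeffForm k α b = b.coeff α := rfl

end MonoidAlgebraMaps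

/-! ### Differential operators on monoid algebras -/

section DiffOpsMonoidAlgebra

variable {k : Type*} [Field k]

section Comp

variable {A B : Type*} [CommRing A] [Algebra k A] [CommRing B] [Algebra k B]

theorem IsDiffOpOfOrder.smul {n : ℕ} {D : Module.End k A} (c : k) (h : IsDiffOpOfOrder k n D) :
    IsDiffOpOfOrder k n (c • D) := by
  rw [Algebra.smul_def]
  exact IsDiffOpOfOrder.mul (zero_add n) (IsDiffOpOfOrder.algebraMap c) h

theorem isDiffOpOfOrder_mulLeft (a : A) : IsDiffOpOfOrder k 0 (LinearMap.mulLeft k a) := by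
  intro b
  ext c
  simp [mul_left_comm]

/-- Restricting a differential operator along a retraction of algebras. -/
theorem IsDiffOpOfOrder.retract (i : A →ₐ[k] B) (p : B →ₐ[k] A) (hpi : ∀ a, p (i a) = a) {n : ℕ}
    {F : Module.End k B} (hF : IsDiffOpOfOrder k n F) :
    IsDiffOpOfOrder k n (p.toLinearMap ∘ₗ F ∘ₗ i.toLinearMap) := by
  have key : ∀ (F : Module.End k B) (a : A),
      (p.toLinearMap ∘ₗ F ∘ₗ i.toLinearMap : Module.End k A) * LinearMap.mulLeft k a
          - LinearMap.mulLeft k a * (p.toLinearMap ∘ₗ F ∘ₗ i.toLinearMap : Module.End k A)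
        = p.toLinearMap ∘ₗ (F * LinearMap.mulLeft k (i a) - LinearMap.mulLeft k (i a) * F)
            ∘ₗ i.toLinearMap := by
    intro F a
    ext b
    simp [hpi]
  induction n generalizing F with
  | zero => intro a; rw [key, hF (i a)]; simp
  | succ n ih => intro a; rw [key]; exact ih (hF (i a))

end Comp

variable {M : Type*} [AddCommMonoid M]

/-- Commutators depend linearly on the function, so conditions on them can be tested on monomials.
-/
theorem commutator_induction {P : Module.End k (AddMonoidAlgebra k M) → Prop}
    (h0 : P 0) (hadd : ∀ D E, P D → P E → P (D + E)) (hsmul : ∀ (c : k) D, P D → P (c • D))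
    {D : Module.End k (AddMonoidAlgebra k M)}
    (h : ∀ α, P (D * LinearMap.mulLeft k (AddMonoidAlgebra.single α (1 : k))
      - LinearMap.mulLeft k (AddMonoidAlgebra.single α (1 : k)) * D))
    (a : AddMonoidAlgebra k M) : P (D * LinearMap.mulLeft k a - LinearMap.mulLeft k a * D) := by
  induction a using AddMonoidAlgebra.induction_linear with
  | zero => simpa using h0
  | add a b ha hb =>
    have : D * LinearMap.mulLeft k (a + b) - LinearMap.mulLeft k (a + b) * D
        = (D * LinearMap.mulLeft k a - LinearMap.mulLeft k a * D)
          + (D * LinearMap.mulLeft k b - LinearMap.mulLeft k b * D) := by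
      refine LinearMap.ext fun x => ?_
      simp [add_mul]
      abel
    rw [this]
    exact hadd _ _ ha hb
  | single α c =>
    have : D * LinearMap.mulLeft k (AddMonoidAlgebra.single α c)
          - LinearMap.mulLeft k (AddMonoidAlgebra.single α c) * D
        = c • (D * LinearMap.mulLeft k (AddMonoidAlgebra.single α (1 : k))
          - LinearMap.mulLeft k (AddMonoidAlgebra.single α (1 : k)) * D) := by
      refine LinearMap.ext fun x => ?_
      rw [single_eq_smul]
      simp only [LinearMap.sub_apply, Module.End.mul_apply, LinearMap.mulLeft_apply,
        LinearMap.smul_apply, smul_mul_assoc, map_smul, smul_sub]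
    rw [this]
    exact hsmul _ _ (h α)

theorem isDiffOpOfOrder_zero_of_single {D : Module.End k (AddMonoidAlgebra k M)}
    (h : ∀ α, D * LinearMap.mulLeft k (AddMonoidAlgebra.single α (1 : k))
      - LinearMap.mulLeft k (AddMonoidAlgebra.single α (1 : k)) * D = 0) :
    IsDiffOpOfOrder k 0 D :=
  fun a => commutator_induction (P := fun E => E = 0) rfl (by rintro _ _ rfl rfl; simp)
    (by rintro c _ rfl; simp) h a

theorem isDiffOpOfOrder_succ_of_single {n : ℕ} {D : Module.End k (AddMonoidAlgebra k M)}
    (h : ∀ α, IsDiffOpOfOrder k n (D * LinearMap.mulLeft k (AddMonoidAlgebra.single α (1 : k))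
      - LinearMap.mulLeft k (AddMonoidAlgebra.single α (1 : k)) * D)) :
    IsDiffOpOfOrder k (n + 1) D :=
  fun a => commutator_induction (P := IsDiffOpOfOrder k n) (IsDiffOpOfOrder.zero n)
    (fun _ _ h h' => h.add h') (fun c _ h => h.smul c) h a

variable {m : ℕ}

theorem torusAct_apply (wt : M →+ (Fin m → ℤ)) (g : Torus k m) (b : AddMonoidAlgebra k M) :
    torusAct wt g b = torusActHom wt g b := rfl

theorem coeff_torusAct (wt : M →+ (Fin m → ℤ)) (g : Torus k m) (b : AddMonoidAlgebra k M) (α : M) :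
    (torusAct wt g b).coeff α = b.coeff α * (character (wt α) g : k) := by
  classical
  rw [torusAct_apply]
  induction b using AddMonoidAlgebra.induction_linear with
  | zero => simp
  | add b b' hb hb' => simp [hb, hb', add_mul]
  | single β d =>
    rw [torusActHom_single, AddMonoidAlgebra.coeff_single, AddMonoidAlgebra.coeff_single,
      Finsupp.single_apply, Finsupp.single_apply]
    split_ifs with h
    · rw [h]
    · rw [zero_mul]

/-- The operator `D` changes the weights of monomials by elements of `Λ`. -/
def ShiftsWeightsBy (wt : M →+ (Fin m → ℤ)) (Λ : AddSubgroup (Fin m → ℤ))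
    (D : Module.End k (AddMonoidAlgebra k M)) : Prop :=
  ∀ α β, (D (AddMonoidAlgebra.single α 1)).coeff β ≠ 0 → wt β - wt α ∈ Λ

/-- In the monomial basis, conjugation by g multiplies the matrix entry from α to β by the value at
g of the character wt β - wt α. Invariance under H thus says that this character is trivial on H
whenever the entry is nonzero. -/
theorem conj_torusAct_eq_iff (wt : M →+ (Fin m → ℤ)) (H : Subgroup (Torus k m))
    (Λ : AddSubgroup (Fin m → ℤ)) (hΛ : ∀ χ, (∀ g ∈ H, character χ g = 1) ↔ χ ∈ Λ)
    (D : Module.End k (AddMonoidAlgebra k M)) :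
    (∀ g ∈ H, (torusAct wt g).toLinearEquiv.conj D = D) ↔ ShiftsWeightsBy wt Λ D := by
  have h1 : ∀ g : Torus k m, (torusAct wt g).toLinearEquiv.conj D = D ↔
      ∀ b, torusAct wt g (D b) = D (torusAct wt g b) := by
    intro g
    constructor
    · intro h b
      conv_rhs => rw [← h]
      simp [LinearEquiv.conj_apply]
    · intro h
      refine LinearMap.ext fun b => ?_
      change torusAct wt g (D ((torusAct wt g).symm b)) = D b
      rw [h, AlgEquiv.apply_symm_apply]
  have h2 : ∀ g : Torus k m, (∀ b, torusAct wt g (D b) = D (torusAct wt g b)) ↔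
      ∀ α β, (D (AddMonoidAlgebra.single α 1)).coeff β ≠ 0 → character (wt β - wt α) g = 1 := by
    intro g
    have h3 : ∀ α, D (torusAct wt g (AddMonoidAlgebra.single α 1))
        = (character (wt α) g : k) • D (AddMonoidAlgebra.single α 1) := by
      intro α
      rw [torusAct_apply, torusActHom_single, one_mul, single_eq_smul, map_smul]
    constructor
    · intro h α β hne
      have h4 := congrArg (fun b => b.coeff β) (h (AddMonoidAlgebra.single α 1))
      simp only [h3, coeff_torusAct, AddMonoidAlgebra.coeff_smul_apply, smul_eq_mul] at h4
      rw [mul_comm] at h4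
      rw [character_sub, Units.ext (mul_right_cancel₀ hne h4), div_self']
    · intro h b
      suffices (torusAct wt g).toLinearMap ∘ₗ D = D ∘ₗ (torusAct wt g).toLinearMap from
        LinearMap.congr_fun this b
      refine linearMap_ext_single fun α => ?_
      change torusAct wt g (D _) = D (torusAct wt g _)
      rw [h3]
      ext β
      rw [coeff_torusAct, AddMonoidAlgebra.coeff_smul_apply, smul_eq_mul]
      by_cases h0 : (D (AddMonoidAlgebra.single α 1)).coeff β = 0
      · simp [h0]
      · have h5 := h α β h0
        rw [character_sub, div_eq_one] at h5
        rw [h5, mul_comm]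
  simp only [h1, h2, ShiftsWeightsBy, ← hΛ]
  exact ⟨fun h α β hne g hg => h g hg α β hne, fun h g hg α β hne => h α β hne g hg⟩

theorem mem_invDiffOps_iff {wt : M →+ (Fin m → ℤ)} {H : Subgroup (Torus k m)}
    {Λ : AddSubgroup (Fin m → ℤ)} (hΛ : ∀ χ, (∀ g ∈ H, character χ g = 1) ↔ χ ∈ Λ)
    {D : Module.End k (AddMonoidAlgebra k M)} :
    D ∈ invDiffOps (torusAct wt) H ↔
      (∃ n, IsDiffOpOfOrder k n D) ∧ ShiftsWeightsBy wt Λ D := by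
  rw [← conj_torusAct_eq_iff wt H Λ hΛ]
  rfl

end DiffOpsMonoidAlgebra

/-! ### Lifting operators from `V` to `Y` -/

section Lift

/-- The ring of regular functions on `V`. -/
abbrev FunV (k : Type*) [Field k] (r : ℕ) : Type _ := AddMonoidAlgebra k (Fin r → ℕ)

/-- The ring of regular functions on `Y`. -/
abbrev FunY (k : Type*) [Field k] (r s : ℕ) : Type _ :=
  AddMonoidAlgebra k ((Fin r → ℕ) × (Fin s → ℤ))

variable {k : Type*} [Field k] {m r s : ℕ} (L : Matrix (Fin m) (Fin r ⊕ Fin s) ℤ)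

open Classical in
/-- The linear map from functions on `V` to functions on `Y` that multiplies each monomial by a
monomial in the coordinates of `W` so that it gets weight `χ`, and kills it if this is not
possible. -/
def liftToWeight (χ : Fin m → ℤ) : FunV k r →ₗ[k] FunY k r s :=
  monomialLift fun α =>
    if h : ∃ n, weightW L n = χ - weightV L α then AddMonoidAlgebra.single (α, h.choose) 1 else 0

/-- Restriction of functions from `Y` to `V × {1}`. -/
def restrictV (k : Type*) [Field k] (r s : ℕ) : FunY k r s →ₐ[k] FunV k r :=
  AddMonoidAlgebra.mapDomainAlgHom k k (AddMonoidHom.fst _ _)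

/-- Pull-back of functions from `V` to `Y`. -/
def pullV (k : Type*) [Field k] (r s : ℕ) : FunV k r →ₐ[k] FunY k r s :=
  AddMonoidAlgebra.mapDomainAlgHom k k (AddMonoidHom.inl _ _)

theorem restrictV_single (α : Fin r → ℕ) (β : Fin s → ℤ) (c : k) :
    restrictV k r s (AddMonoidAlgebra.single (α, β) c) = AddMonoidAlgebra.single α c := by
  simp [restrictV]

theorem pullV_single (α : Fin r → ℕ) (c : k) :
    pullV k r s (AddMonoidAlgebra.single α c) = AddMonoidAlgebra.single (α, 0) c := by
  simp [pullV]

theorem restrictV_pullV (a : FunV k r) : restrictV k r s (pullV k r s a) = a := by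
  suffices (restrictV k r s).toLinearMap ∘ₗ (pullV k r s).toLinearMap = LinearMap.id from
    LinearMap.congr_fun this a
  refine linearMap_ext_single fun α => ?_
  simp [pullV_single, restrictV_single]

/-- The operator on functions on `Y` that shifts weights by `ψ` and corresponds to the operator `D`
on functions on `V` under restriction. -/
def liftOp (ψ : Fin m → ℤ) (D : Module.End k (FunV k r)) : Module.End k (FunY k r s) :=
  monomialLift fun p => liftToWeight L (weightY L p + ψ) (D (AddMonoidAlgebra.single p.1 1))

variable {L}

theorem liftOp_single (ψ : Fin m → ℤ) (D : Module.End k (FunV k r)) (α : Fin r → ℕ)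
    (β : Fin s → ℤ) :
    liftOp L ψ D (AddMonoidAlgebra.single (α, β) 1)
      = liftToWeight L (weightY L (α, β) + ψ) (D (AddMonoidAlgebra.single α 1)) := by
  rw [liftOp, monomialLift_single, one_smul]

/-- Injectivity of `weightW` leaves a single candidate for the chosen exponent. -/
theorem liftToWeight_single (hL : Function.Injective (weightW L)) {χ : Fin m → ℤ}
    {α : Fin r → ℕ} {n : Fin s → ℤ} (h : weightY L (α, n) = χ) (c : k) :
    liftToWeight L χ (AddMonoidAlgebra.single α c) = AddMonoidAlgebra.single (α, n) c := by
  have h' : ∃ n, weightW L n = χ - weightV L α := ⟨n, by rw [← h, weightY_apply]; abel⟩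
  have h'' : h'.choose = n := hL (by rw [h'.choose_spec, ← h, weightY_apply]; abel)
  rw [liftToWeight, monomialLift_single, dif_pos h', h'']
  simp

theorem liftToWeight_single_of_not_mem {χ : Fin m → ℤ} {α : Fin r → ℕ}
    (h : χ - weightV L α ∉ (weightW L).range) (c : k) :
    liftToWeight L χ (AddMonoidAlgebra.single α c) = 0 := by
  rw [liftToWeight, monomialLift_single, dif_neg (show ¬∃ n, _ from h), smul_zero]

theorem coeff_liftToWeight {χ : Fin m → ℤ} {a : FunV k r} {p : (Fin r → ℕ) × (Fin s → ℤ)}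
    (h : (liftToWeight L χ a).coeff p ≠ 0) : weightY L p = χ := by
  by_contra hne
  refine h ?_
  suffices coeffForm k p ∘ₗ liftToWeight L χ = 0 from LinearMap.congr_fun this a
  refine linearMap_ext_single fun α => ?_
  rw [LinearMap.comp_apply, liftToWeight, monomialLift_single, one_smul]
  split_ifs with h'
  · rw [coeffForm_apply, AddMonoidAlgebra.coeff_single, Finsupp.single_eq_of_ne]
    · rfl
    · rintro rfl
      exact hne (by rw [weightY_apply, h'.choose_spec]; abel)
  · simp

theorem single_mul_liftToWeight (hL : Function.Injective (weightW L)) (χ : Fin m → ℤ)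
    (a : Fin r → ℕ) (b : Fin s → ℤ) (f : FunV k r) :
    AddMonoidAlgebra.single (a, b) 1 * liftToWeight L χ f
      = liftToWeight L (weightY L (a, b) + χ) (AddMonoidAlgebra.single a 1 * f) := by
  suffices LinearMap.mulLeft k (AddMonoidAlgebra.single (a, b) 1) ∘ₗ liftToWeight L χ
      = liftToWeight L (weightY L (a, b) + χ) ∘ₗ LinearMap.mulLeft k (AddMonoidAlgebra.single a 1)
    from LinearMap.congr_fun this f
  refine linearMap_ext_single fun α => ?_
  simp only [LinearMap.comp_apply, LinearMap.mulLeft_apply, AddMonoidAlgebra.single_mul_single,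
    one_mul]
  by_cases h : χ - weightV L α ∈ (weightW L).range
  · obtain ⟨n, hn⟩ := h
    have h1 : weightY L (α, n) = χ := by rw [weightY_apply, hn]; abel
    rw [liftToWeight_single hL h1, AddMonoidAlgebra.single_mul_single, one_mul]
    refine (liftToWeight_single hL ?_ 1).symm
    rw [← h1, ← map_add]
    rfl
  · rw [liftToWeight_single_of_not_mem h, mul_zero, liftToWeight_single_of_not_mem]
    intro h'
    refine h ?_
    have h2 : χ - weightV L α
        = weightY L (a, b) + χ - weightV L (a + α) - weightW L b := by
      rw [weightY_apply, map_add]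
      abel
    rw [h2]
    exact sub_mem h' ⟨b, rfl⟩

/-- This is what makes lifts differential operators, by induction on the order. The commutator
shifts weights further by the weight of the monomial, which is why `liftOp` has the parameter ψ
although the final homomorphism uses only ψ = 0. -/
theorem commutator_liftOp (hL : Function.Injective (weightW L)) (ψ : Fin m → ℤ)
    (D : Module.End k (FunV k r)) (a : Fin r → ℕ) (b : Fin s → ℤ) :
    liftOp L ψ D * LinearMap.mulLeft k (AddMonoidAlgebra.single (a, b) 1)
        - LinearMap.mulLeft k (AddMonoidAlgebra.single (a, b) 1) * liftOp L ψ D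
      = liftOp L (weightY L (a, b) + ψ) (D * LinearMap.mulLeft k (AddMonoidAlgebra.single a 1)
        - LinearMap.mulLeft k (AddMonoidAlgebra.single a 1) * D) := by
  refine linearMap_ext_single fun p => ?_
  obtain ⟨α, β⟩ := p
  simp only [LinearMap.sub_apply, Module.End.mul_apply, LinearMap.mulLeft_apply,
    AddMonoidAlgebra.single_mul_single, one_mul, Prod.mk_add_mk, liftOp_single, map_sub,
    single_mul_liftToWeight hL]
  have h1 : weightY L (a + α, b + β) = weightY L (a, b) + weightY L (α, β) := by
    rw [← map_add]; rfl
  rw [h1]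
  congr 3 <;> abel

theorem liftOp_zero (ψ : Fin m → ℤ) : liftOp L ψ (0 : Module.End k (FunV k r)) = 0 := by
  refine linearMap_ext_single fun p => ?_
  rw [liftOp_single]
  simp

theorem IsDiffOpOfOrder.liftOp (hL : Function.Injective (weightW L)) {n : ℕ}
    {D : Module.End k (FunV k r)} (hD : IsDiffOpOfOrder k n D) (ψ : Fin m → ℤ) :
    IsDiffOpOfOrder k n (liftOp L ψ D) := by
  induction n generalizing D ψ with
  | zero =>
    refine isDiffOpOfOrder_zero_of_single fun p => ?_
    rw [commutator_liftOp hL ψ D p.1 p.2, hD, liftOp_zero]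
  | succ n ih =>
    refine isDiffOpOfOrder_succ_of_single fun p => ?_
    rw [commutator_liftOp hL ψ D p.1 p.2]
    exact ih (hD _) _

theorem shiftsWeightsBy_liftOp (D : Module.End k (FunV k r)) :
    ShiftsWeightsBy (weightY L) ⊥ (liftOp L 0 D) := by
  intro p q h
  rw [liftOp_single, add_zero] at h
  rw [coeff_liftToWeight h]
  simp

/-- The source of multiplicativity of the lift. Invariance of D matters for the monomials killed by
`liftToWeight`: D keeps their weights in the same class modulo Λ, so their images are killed as
well. -/
theorem liftOp_liftToWeight (hL : Function.Injective (weightW L)) {D : Module.End k (FunV k r)}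
    (hD : ShiftsWeightsBy (weightV L) (weightW L).range D) (χ : Fin m → ℤ) (a : FunV k r) :
    liftOp L 0 D (liftToWeight L χ a) = liftToWeight L χ (D a) := by
  suffices liftOp L 0 D ∘ₗ liftToWeight L χ = liftToWeight L χ ∘ₗ D from
    LinearMap.congr_fun this a
  refine linearMap_ext_single fun α => ?_
  simp only [LinearMap.comp_apply]
  by_cases h : χ - weightV L α ∈ (weightW L).range
  · obtain ⟨n, hn⟩ := h
    have h1 : weightY L (α, n) = χ := by rw [weightY_apply, hn]; abel
    rw [liftToWeight_single hL h1, liftOp_single, h1, add_zero]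
  · rw [liftToWeight_single_of_not_mem h, map_zero]
    symm
    refine linearMap_eq_of_coeff _ 0 _ fun β hβ => ?_
    rw [liftToWeight_single_of_not_mem, LinearMap.zero_apply]
    intro h'
    refine h ?_
    have h2 : χ - weightV L α = χ - weightV L β + (weightV L β - weightV L α) := by abel
    rw [h2]
    exact add_mem h' (hD α β hβ)

/-- With `restrictV_liftToWeight`, this identifies functions of weight χ on Y with functions on V
having weights in χ + Λ. -/
theorem liftToWeight_restrictV (hL : Function.Injective (weightW L)) {χ : Fin m → ℤ}
    {b : FunY k r s} (hb : ∀ p, b.coeff p ≠ 0 → weightY L p = χ) :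
    liftToWeight L χ (restrictV k r s b) = b := by
  refine linearMap_eq_of_coeff (liftToWeight L χ ∘ₗ (restrictV k r s).toLinearMap) LinearMap.id b
    fun p hp => ?_
  obtain ⟨α, β⟩ := p
  simp only [LinearMap.comp_apply, AlgHom.toLinearMap_apply, LinearMap.id_apply]
  rw [restrictV_single, liftToWeight_single hL (hb _ hp)]

theorem restrictV_liftToWeight {χ : Fin m → ℤ}
    {a : FunV k r} (ha : ∀ α, a.coeff α ≠ 0 → χ - weightV L α ∈ (weightW L).range) :
    restrictV k r s (liftToWeight L χ a) = a := by
  refine linearMap_eq_of_coeff ((restrictV k r s).toLinearMap ∘ₗ liftToWeight L χ) LinearMap.id a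
    fun α hα => ?_
  have h' : ∃ n, weightW L n = χ - weightV L α := ha α hα
  simp only [LinearMap.comp_apply, AlgHom.toLinearMap_apply, LinearMap.id_apply]
  rw [liftToWeight, monomialLift_single, dif_pos h', one_smul, restrictV_single]

theorem restrictV_liftOp_single {D : Module.End k (FunV k r)}
    (hD : ShiftsWeightsBy (weightV L) (weightW L).range D) (α : Fin r → ℕ) (β : Fin s → ℤ) :
    restrictV k r s (liftOp L 0 D (AddMonoidAlgebra.single (α, β) 1))
      = D (AddMonoidAlgebra.single α 1) := by
  rw [liftOp_single]
  refine restrictV_liftToWeight fun α' h => ?_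
  have h2 : weightY L (α, β) + 0 - weightV L α'
      = weightW L β - (weightV L α' - weightV L α) := by
    rw [weightY_apply]
    abel
  rw [h2]
  exact sub_mem ⟨β, rfl⟩ (hD α α' h)

theorem liftOp_algebraMap (hL : Function.Injective (weightW L)) (c : k) :
    liftOp L 0 (algebraMap k (Module.End k (FunV k r)) c)
      = algebraMap k (Module.End k (FunY k r s)) c := by
  refine linearMap_ext_single fun p => ?_
  obtain ⟨α, β⟩ := p
  rw [liftOp_single, Module.algebraMap_end_apply, Module.algebraMap_end_apply, map_smul,
    liftToWeight_single hL (add_zero _).symm]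

/-! ### Invariant operators in terms of weights, and the homomorphism ξ. -/

theorem character_eq_one_on_top_iff [IsAlgClosed k] [CharZero k] (χ : Fin m → ℤ) :
    (∀ g ∈ (⊤ : Subgroup (Torus k m)), character χ g = 1) ↔ χ ∈ (⊥ : AddSubgroup (Fin m → ℤ)) := by
  rw [AddSubgroup.mem_bot]
  constructor
  · intro h
    exact eq_of_character_eq (k := k) fun g => by rw [h g trivial, character_zero]
  · rintro rfl g -
    exact character_zero g

theorem mem_invDiffOpsV_iff [IsAlgClosed k] [CharZero k] {w : Fin s → kˣ}
    {D : Module.End k (FunV k r)} : D ∈ invDiffOpsV L (stabW L w) ↔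
      (∃ n, IsDiffOpOfOrder k n D) ∧ ShiftsWeightsBy (weightV L) (weightW L).range D :=
  mem_invDiffOps_iff (character_eq_one_iff L w)

theorem mem_invDiffOpsY_iff [IsAlgClosed k] [CharZero k] {F : Module.End k (FunY k r s)} :
    F ∈ invDiffOpsY k L ↔
      (∃ n, IsDiffOpOfOrder k n F) ∧ ShiftsWeightsBy (weightY L) ⊥ F :=
  mem_invDiffOps_iff character_eq_one_on_top_iff

/-- The homomorphism from the algebra of invariant operators on `V` to that on `Y`. -/
def liftHom [IsAlgClosed k] [CharZero k] (hL : Function.Injective (weightW L)) (w : Fin s → kˣ) :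
    invDiffOpsV L (stabW L w) →ₐ[k] invDiffOpsY k L :=
  AlgHom.codRestrict
    (
    { toFun := fun D => liftOp L 0 (D : Module.End k (FunV k r))
      map_one' := by simpa using liftOp_algebraMap (r := r) hL (1 : k)
      map_zero' := liftOp_zero 0
      map_add' := fun D E => by
        refine linearMap_ext_single fun p => ?_
        obtain ⟨α, β⟩ := p
        simp [liftOp_single]
      map_mul' := fun D E => by
        refine linearMap_ext_single fun p => ?_
        obtain ⟨α, β⟩ := p
        rw [Module.End.mul_apply, liftOp_single, liftOp_single,
          liftOp_liftToWeight hL (mem_invDiffOpsV_iff.mp D.2).2]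
        rfl
      commutes' := fun c => liftOp_algebraMap hL c } :
      invDiffOpsV L (stabW L w) →ₐ[k] Module.End k (FunY k r s))
    (invDiffOpsY k L) fun D => mem_invDiffOpsY_iff.mpr
      ⟨(mem_invDiffOpsV_iff.mp D.2).1.imp fun _ h => h.liftOp hL 0, shiftsWeightsBy_liftOp _⟩

theorem coe_liftHom [IsAlgClosed k] [CharZero k] (hL : Function.Injective (weightW L))
    (w : Fin s → kˣ) (D : invDiffOpsV L (stabW L w)) :
    (liftHom hL w D : Module.End k (FunY k r s)) = liftOp L 0 (D : Module.End k (FunV k r)) := rfl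

/-- Applying the lift to a function pulled back from V and restricting to V × {1} gives back D. -/
theorem liftHom_injective [IsAlgClosed k] [CharZero k] (hL : Function.Injective (weightW L))
    (w : Fin s → kˣ) : Function.Injective (liftHom hL w : invDiffOpsV L (stabW L w) → _) := by
  intro D E h
  refine Subtype.ext (linearMap_ext_single fun α => ?_)
  have h1 := congrArg (fun F : invDiffOpsY k L => restrictV k r s
    ((F : Module.End k (FunY k r s)) (AddMonoidAlgebra.single (α, 0) 1))) h
  simpa only [coe_liftHom, restrictV_liftOp_single (mem_invDiffOpsV_iff.mp D.2).2,
    restrictV_liftOp_single (mem_invDiffOpsV_iff.mp E.2).2] using h1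

end Lift

/-! ### Generators of the algebra of invariant operators on `Y` -/

section Generators

variable {k : Type*} [Field k] {m r s : ℕ} {L : Matrix (Fin m) (Fin r ⊕ Fin s) ℤ}

/-- Bernoulli polynomials are discrete antiderivatives: B_{n+1}(t + 1) - B_{n+1}(t) = (n + 1) t ^ n,
and n + 1 is invertible in characteristic 0. -/
theorem exists_comp_X_add_one_sub [CharZero k] (p : Polynomial k) :
    ∃ P : Polynomial k, P.comp (Polynomial.X + 1) - P = p := by
  induction p using Polynomial.induction_on' with
  | add p q hp hq =>
    obtain ⟨P, rfl⟩ := hp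
    obtain ⟨Q, rfl⟩ := hq
    exact ⟨P + Q, by rw [Polynomial.add_comp]; ring⟩
  | monomial n c =>
    have h1 : ((Polynomial.bernoulli (n + 1)).map (algebraMap ℚ k)).comp (Polynomial.X + 1)
        = (Polynomial.bernoulli (n + 1)).map (algebraMap ℚ k)
          + ((n + 1 : ℕ) : Polynomial k) * Polynomial.X ^ n := by
      have h2 := congrArg (Polynomial.map (algebraMap ℚ k))
        (Polynomial.bernoulli_comp_one_add_X (n + 1))
      rw [Polynomial.map_comp, add_comm 1] at h2
      simpa [nsmul_eq_mul] using h2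
    have hn : ((n : k) + 1) ≠ 0 := Nat.cast_add_one_ne_zero n
    refine ⟨Polynomial.C (c / (n + 1)) * (Polynomial.bernoulli (n + 1)).map (algebraMap ℚ k), ?_⟩
    rw [Polynomial.mul_comp, Polynomial.C_comp, h1, mul_add, add_sub_cancel_left, ← mul_assoc,
      ← Polynomial.C_eq_natCast, ← Polynomial.C_mul, Polynomial.C_mul_X_pow_eq_monomial]
    push_cast
    rw [div_mul_cancel₀ c hn]

/-- Moving q to the left past a polynomial in x shifts its argument by one, so the commutator with q
acts as a difference operator on polynomials in x. -/
theorem aeval_mul_of_semiconj {E : Type*} [Ring E] [Algebra k E] {x q : E}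
    (h : x * q = q * (x + 1)) (p : Polynomial k) :
    Polynomial.aeval x p * q = q * Polynomial.aeval x (p.comp (Polynomial.X + 1)) := by
  rw [Polynomial.aeval_comp]
  simp only [map_add, Polynomial.aeval_X, map_one]
  induction p using Polynomial.induction_on' with
  | add p p' hp hp' => simp only [map_add, add_mul, mul_add, hp, hp']
  | monomial n c =>
    have h1 : ∀ n : ℕ, x ^ n * q = q * (x + 1) ^ n := by
      intro n
      induction n with
      | zero => simp
      | succ n ih => rw [pow_succ, mul_assoc, h, ← mul_assoc, ih, mul_assoc, ← pow_succ]
    rw [Polynomial.aeval_monomial, Polynomial.aeval_monomial, mul_assoc, h1, ← mul_assoc,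
      Algebra.commutes c q, mul_assoc]

/-- Multiplication by a monomial in the coordinates of `W`. -/
def mulW (k : Type*) [Field k] (r : ℕ) {s : ℕ} (b : Fin s → ℤ) : Module.End k (FunY k r s) :=
  LinearMap.mulLeft k (AddMonoidAlgebra.single (0, b) 1)

theorem mulW_single (b : Fin s → ℤ) (α : Fin r → ℕ) (β : Fin s → ℤ) (c : k) :
    mulW k r b (AddMonoidAlgebra.single (α, β) c) = AddMonoidAlgebra.single (α, b + β) c := by
  simp [mulW, AddMonoidAlgebra.single_mul_single]

theorem mulW_mul (b c : Fin s → ℤ) : mulW k r b * mulW k r c = mulW k r (b + c) := by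
  refine linearMap_ext_single fun p => ?_
  obtain ⟨α, β⟩ := p
  rw [Module.End.mul_apply, mulW_single, mulW_single, mulW_single, add_assoc]

theorem mulW_zero : mulW k r (0 : Fin s → ℤ) = 1 := by
  refine linearMap_ext_single fun p => ?_
  obtain ⟨α, β⟩ := p
  rw [mulW_single, zero_add, Module.End.one_apply]

theorem mulW_commute (b c : Fin s → ℤ) : Commute (mulW k r b) (mulW k r c) := by
  rw [commute_iff_eq, mulW_mul, mulW_mul, add_comm]

theorem restrictV_mulW (b : Fin s → ℤ) (f : FunY k r s) :
    restrictV k r s (mulW k r b f) = restrictV k r s f := by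
  rw [mulW, LinearMap.mulLeft_apply, map_mul, restrictV_single]
  exact one_mul _

theorem coeff_mulW (b : Fin s → ℤ) (f : FunY k r s) (α : Fin r → ℕ) (β : Fin s → ℤ) :
    (mulW k r b f).coeff (α, β) = f.coeff (α, β - b) := by
  rw [mulW, LinearMap.mulLeft_apply,
    AddMonoidAlgebra.coeff_single_mul_eq_mul_coeff (m₂ := (α, β - b)), one_mul]
  rintro ⟨α', β'⟩ -
  simp [eq_sub_iff_add_eq, add_comm]

theorem ShiftsWeightsBy.conj_mulW {F : Module.End k (FunY k r s)}
    (hF : ShiftsWeightsBy (weightY L) ⊥ F) (b : Fin s → ℤ) :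
    ShiftsWeightsBy (weightY L) ⊥ (mulW k r (-b) * F * mulW k r b) := by
  rintro ⟨α, β⟩ ⟨α', β'⟩ h
  rw [Module.End.mul_apply, Module.End.mul_apply, mulW_single, coeff_mulW, sub_neg_eq_add] at h
  have h1 := hF _ _ h
  rw [weightY_apply, weightY_apply, map_add, map_add] at h1
  rw [weightY_apply, weightY_apply]
  convert h1 using 1
  abel

theorem lieOp_weightY_single (x : Fin m → k) (p : (Fin r → ℕ) × (Fin s → ℤ)) (c : k) :
    lieOp (weightY L) x (AddMonoidAlgebra.single p c)
      = diffCharacter x (weightY L p) • AddMonoidAlgebra.single p c := by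
  rw [lieOp_single, AddMonoidAlgebra.smul_single, smul_eq_mul, mul_comm]
  rfl

/-- The Lie algebra of the torus acts by central elements of the algebra of invariant operators. -/
theorem lieOp_commute {F : Module.End k (FunY k r s)} (hF : ShiftsWeightsBy (weightY L) ⊥ F)
    (x : Fin m → k) : lieOp (weightY L) x * F = F * lieOp (weightY L) x := by
  refine linearMap_ext_single fun p => ?_
  rw [Module.End.mul_apply, Module.End.mul_apply, lieOp_weightY_single, map_smul]
  refine linearMap_eq_of_coeff (lieOp (weightY L) x)
    (diffCharacter x (weightY L p) • LinearMap.id) _ fun q hq => ?_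
  have h1 : weightY L q = weightY L p := sub_eq_zero.mp (by simpa using hF p q hq)
  rw [lieOp_weightY_single, h1]
  rfl

theorem lieOp_mul_mulW (x : Fin m → k) (b : Fin s → ℤ) :
    lieOp (weightY L) x * mulW k r b = mulW k r b * (lieOp (weightY L) x
      + algebraMap k _ (diffCharacter x (weightW L b))) := by
  refine linearMap_ext_single fun p => ?_
  obtain ⟨α, β⟩ := p
  simp only [Module.End.mul_apply, LinearMap.add_apply, mulW_single, lieOp_weightY_single,
    Module.algebraMap_end_apply, map_add, map_smul, weightY_apply, ← add_smul]
  congr 1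
  abel

variable (k L) in
/-- The invariant operators on `Y` that commute with the coordinates of `W` outside `S`. -/
def commutingOps (S : Finset (Fin s)) : Subalgebra k (Module.End k (FunY k r s)) :=
  invDiffOpsY k L ⊓
    Subalgebra.centralizer k ((fun j => mulW k r (Pi.single j 1)) '' {j : Fin s | j ∉ S})

theorem mem_commutingOps {S : Finset (Fin s)} {F : Module.End k (FunY k r s)} :
    F ∈ commutingOps k L S ↔ F ∈ invDiffOpsY k L ∧
      ∀ j ∉ S, mulW k r (Pi.single j 1) * F = F * mulW k r (Pi.single j 1) := by
  simp [commutingOps, Algebra.mem_inf, Subalgebra.mem_centralizer_iff]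

variable [IsAlgClosed k] [CharZero k]

/-- An invariant operator on `Y` that commutes with the coordinates of `W` is the lift of an
invariant operator on `V`. -/
theorem exists_liftOp_eq (hL : Function.Injective (weightW L)) (w : Fin s → kˣ)
    {F : Module.End k (FunY k r s)} (hF : F ∈ commutingOps k L ∅) :
    ∃ D ∈ invDiffOpsV L (stabW L w), liftOp L 0 D = F := by
  obtain ⟨hFY, hFc⟩ := mem_commutingOps.mp hF
  obtain ⟨⟨n, hn⟩, hFw⟩ := mem_invDiffOpsY_iff.mp hFY
  have hconst : ∀ α β, restrictV k r s (F (AddMonoidAlgebra.single (α, β) 1))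
      = restrictV k r s (F (AddMonoidAlgebra.single (α, 0) 1)) := by
    intro α β
    -- The translations of the W-exponent that do not change the restricted value form a group, and
    -- commutation with the coordinates puts the standard basis in it.
    let Λ : AddSubgroup (Fin s → ℤ) :=
      { carrier := {b | ∀ c, restrictV k r s (F (AddMonoidAlgebra.single (α, b + c) 1))
          = restrictV k r s (F (AddMonoidAlgebra.single (α, c) 1))}
        zero_mem' := fun c => by rw [zero_add]
        add_mem' := fun {b b'} hb hb' c => by rw [add_assoc, hb, hb']
        neg_mem' := fun {b} hb c => by rw [← hb, add_neg_cancel_left] }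
    have hΛ : ∀ j, Pi.single j 1 ∈ Λ := by
      intro j c
      rw [← mulW_single, ← Module.End.mul_apply, ← hFc j (Finset.notMem_empty j),
        Module.End.mul_apply, restrictV_mulW]
    have hβ : β ∈ Λ := by
      rw [pi_eq_sum_univ' β]
      exact sum_mem fun j _ => zsmul_mem (hΛ j) (β j)
    simpa using hβ 0
  let D : Module.End k (FunV k r) := (restrictV k r s).toLinearMap ∘ₗ F ∘ₗ (pullV k r s).toLinearMap
  have hDs : ∀ α, D (AddMonoidAlgebra.single α 1)
      = restrictV k r s (F (AddMonoidAlgebra.single (α, 0) 1)) := by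
    intro α
    simp [D, pullV_single]
  refine ⟨D, mem_invDiffOpsV_iff.mpr ⟨⟨n, hn.retract _ _ restrictV_pullV⟩, ?_⟩, ?_⟩
  · intro α α' h
    rw [hDs] at h
    by_contra hne
    refine h (linearMap_eq_of_coeff (coeffForm k α' ∘ₗ (restrictV k r s).toLinearMap) 0 _ ?_)
    rintro ⟨α'', β⟩ hβ
    simp only [LinearMap.comp_apply, AlgHom.toLinearMap_apply, LinearMap.zero_apply,
      restrictV_single, coeffForm_apply, AddMonoidAlgebra.coeff_single]
    refine Finsupp.single_eq_of_ne ?_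
    rintro rfl
    have h1 := hFw _ _ hβ
    rw [AddSubgroup.mem_bot, weightY_apply, weightY_apply, map_zero, add_zero, sub_eq_zero] at h1
    exact hne ⟨-β, by rw [map_neg, ← h1]; abel⟩
  · refine linearMap_ext_single fun p => ?_
    obtain ⟨α, β⟩ := p
    rw [liftOp_single, hDs, ← hconst α β, add_zero]
    exact liftToWeight_restrictV hL fun q hq => sub_eq_zero.mp (by simpa using hFw _ q hq)

/-- The operators that commute with all but one more coordinate of `W` are polynomials in the
corresponding central operator: they are found by integrating their differences. -/
theorem commutingOps_insert_le {S : Finset (Fin s)} {i : Fin s} (hi : i ∉ S) {x : Fin m → k}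
    (hx : ∀ β, diffCharacter x (weightW L β) = β i) {N : ℕ} {F : Module.End k (FunY k r s)}
    (hN : IsDiffOpOfOrder k N F) (hF : F ∈ commutingOps k L (insert i S)) :
    F ∈ Submodule.span k {E | ∃ G ∈ commutingOps k L S, ∃ p : Polynomial k,
      E = G * Polynomial.aeval (lieOp (weightY L) x) p} := by
  set K := Submodule.span k {E | ∃ G ∈ commutingOps k L S, ∃ p : Polynomial k,
    E = G * Polynomial.aeval (lieOp (weightY L) x : Module.End k (FunY k r s)) p} with hK
  set q : Module.End k (FunY k r s) := mulW k r (Pi.single i 1) with hq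
  set q' : Module.End k (FunY k r s) := mulW k r (-Pi.single i 1) with hq'
  have hqq' : q * q' = 1 := by rw [mulW_mul, add_neg_cancel, mulW_zero]
  have hq'q : q' * q = 1 := by rw [mulW_mul, neg_add_cancel, mulW_zero]
  have hxq : lieOp (weightY L) x * q = q * (lieOp (weightY L) x + 1) := by
    rw [hq, lieOp_mul_mulW, hx]
    simp
  have hxmem : lieOp (weightY L) x ∈ commutingOps k L (insert i S) := by
    refine mem_commutingOps.mpr ⟨lieOp_mem _ _ _, fun j hj => ?_⟩
    have hji : i ≠ j := by
      rintro rfl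
      exact hj (Finset.mem_insert_self _ _)
    rw [lieOp_mul_mulW, hx, Pi.single_eq_of_ne hji]
    simp
  have hSle : commutingOps k L S ≤ commutingOps k L (insert i S) := fun E hE =>
    mem_commutingOps.mpr ⟨(mem_commutingOps.mp hE).1, fun j hj =>
      (mem_commutingOps.mp hE).2 j fun h => hj (Finset.mem_insert_of_mem h)⟩
  have hKle : ∀ E ∈ K, E ∈ commutingOps k L (insert i S) := by
    intro E hE
    refine (Submodule.span_le (p := (commutingOps k L (insert i S)).toSubmodule)).mpr ?_ hE
    rintro _ ⟨G, hG, p, rfl⟩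
    change G * _ ∈ commutingOps k L (insert i S)
    exact mul_mem (hSle hG) (Algebra.adjoin_le (Set.singleton_subset_iff.mpr hxmem)
      (Polynomial.aeval_mem_adjoin_singleton k _))
  have hle : ∀ E ∈ commutingOps k L (insert i S), E * q = q * E → E ∈ K := by
    intro E hE hc
    refine Submodule.subset_span ⟨E, mem_commutingOps.mpr ⟨(mem_commutingOps.mp hE).1, ?_⟩, 1, ?_⟩
    · intro j hj
      by_cases hji : j = i
      · subst hji
        exact hc.symm
      · exact (mem_commutingOps.mp hE).2 j (by simp [hji, hj])
    · rw [map_one, mul_one]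
  -- Discrete integration: for G commuting with q, the commutator of G P(x) with q is q G (P(x + 1)
  -- - P(x)).
  have hint : ∀ E ∈ K, ∃ E' ∈ K, E' * q - q * E' = q * E := by
    intro E hE
    induction hE using Submodule.span_induction with
    | mem E h =>
      obtain ⟨G, hG, p, rfl⟩ := h
      obtain ⟨P, hP⟩ := exists_comp_X_add_one_sub p
      have hGq : q * G = G * q := (mem_commutingOps.mp hG).2 i hi
      refine ⟨G * Polynomial.aeval (lieOp (weightY L) x) P,
        Submodule.subset_span ⟨G, hG, P, rfl⟩, ?_⟩
      rw [mul_assoc, aeval_mul_of_semiconj hxq, ← mul_assoc, ← mul_assoc, ← mul_assoc, hGq,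
        ← mul_sub, ← map_sub, hP]
    | zero => exact ⟨0, zero_mem _, by simp⟩
    | add E₁ E₂ _ _ h₁ h₂ =>
      obtain ⟨E₁', hE₁, h₁'⟩ := h₁
      obtain ⟨E₂', hE₂, h₂'⟩ := h₂
      exact ⟨E₁' + E₂', add_mem hE₁ hE₂, by rw [mul_add q E₁ E₂, ← h₁', ← h₂']; noncomm_ring⟩
    | smul c E _ h =>
      obtain ⟨E', hE', h'⟩ := h
      exact ⟨c • E', K.smul_mem c hE', by
        rw [smul_mul_assoc, mul_smul_comm, mul_smul_comm, ← h']; exact (smul_sub c _ _).symm⟩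
  -- An operator of order 0 already commutes with q. Otherwise q' [F, q] has smaller order and lies
  -- in K by induction; subtracting from F an integral of it leaves an operator commuting with q.
  induction N generalizing F with
  | zero => exact hle F hF (sub_eq_zero.mp (hN _))
  | succ N ih =>
    obtain ⟨hFY, hFc⟩ := mem_commutingOps.mp hF
    -- The factor q' cancels the weight of q, so that the commutator becomes an invariant operator
    -- again.
    have hEN : IsDiffOpOfOrder k N (q' * (F * q - q * F)) :=
      IsDiffOpOfOrder.mul (zero_add N) (isDiffOpOfOrder_mulLeft _) (hN _)
    have hEeq : q' * (F * q - q * F) = q' * F * q - F := by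
      rw [mul_sub, ← mul_assoc, ← mul_assoc, hq'q, one_mul]
    have hE : q' * (F * q - q * F) ∈ commutingOps k L (insert i S) := by
      refine mem_commutingOps.mpr ⟨mem_invDiffOpsY_iff.mpr ⟨⟨N, hEN⟩, ?_⟩, fun j hj => ?_⟩
      · rw [hEeq]
        have h1 := (mem_invDiffOpsY_iff.mp hFY).2
        have h2 := h1.conj_mulW (Pi.single i 1)
        intro α β hne
        rw [LinearMap.sub_apply, AddMonoidAlgebra.coeff_sub, Finsupp.sub_apply] at hne
        by_cases h0 : (F (AddMonoidAlgebra.single α 1)).coeff β = 0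
        · rw [h0, sub_zero] at hne
          exact h2 α β hne
        · exact h1 α β h0
      · have h1 : Commute (mulW k r (Pi.single j 1)) F := hFc j hj
        have h2 : Commute (mulW k r (Pi.single j 1)) q := mulW_commute _ _
        have h3 : Commute (mulW k r (Pi.single j 1)) q' := mulW_commute _ _
        exact h3.mul_right ((h1.mul_right h2).sub_right (h2.mul_right h1))
    obtain ⟨F', hF', h'⟩ := hint _ (ih hEN hE)
    rw [← mul_assoc, hqq', one_mul] at h'
    have h4 := hle (F - F') (sub_mem hF (hKle F' hF')) (by
      rw [sub_mul, mul_sub]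
      exact sub_eq_sub_iff_sub_eq_sub.mpr h'.symm)
    simpa using add_mem h4 hF'

/-- The invariant operators on `Y` are generated by the lifts of those on `V` and the Lie algebra
of the torus. -/
theorem invDiffOpsY_le (hL : Function.Injective (weightW L)) (w : Fin s → kˣ) (X : Fin s → Fin m → k)
    (hX : ∀ j β, diffCharacter (X j) (weightW L β) = β j)
    (A : Subalgebra k (Module.End k (FunY k r s)))
    (h1 : ∀ D ∈ invDiffOpsV L (stabW L w), liftOp L 0 D ∈ A)
    (h2 : ∀ j, lieOp (weightY L) (X j) ∈ A) : invDiffOpsY k L ≤ A := by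
  -- Coordinates of W are released one at a time; for the full set the commutation condition is
  -- empty.
  have key : ∀ S, commutingOps k L S ≤ A := by
    intro S
    induction S using Finset.induction_on with
    | empty =>
      intro F hF
      obtain ⟨D, hD, rfl⟩ := exists_liftOp_eq hL w hF
      exact h1 D hD
    | insert i S hi ih =>
      intro F hF
      obtain ⟨⟨N, hN⟩, -⟩ := mem_invDiffOpsY_iff.mp (mem_commutingOps.mp hF).1
      refine (Submodule.span_le (p := A.toSubmodule)).mpr ?_
        (commutingOps_insert_le hi (hX i) hN hF)
      rintro _ ⟨G, hG, p, rfl⟩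
      change G * _ ∈ A
      exact mul_mem (ih hG) (Algebra.adjoin_le (Set.singleton_subset_iff.mpr (h2 i))
        (Polynomial.aeval_mem_adjoin_singleton k _))
  exact fun F hF => key Finset.univ (mem_commutingOps.mpr ⟨hF, fun j hj => by simp at hj⟩)

end Generators

/-! ### The algebra of invariant operators on `Y` as a polynomial algebra -/

section Polynomials

variable {k : Type*} [Field k] [IsAlgClosed k] [CharZero k] {m r s : ℕ}
  {L : Matrix (Fin m) (Fin r ⊕ Fin s) ℤ}

/-- An element of the Lie algebra of the torus as an element of the center of the algebra of
invariant operators on `Y`. -/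
def centralLieOp (L : Matrix (Fin m) (Fin r ⊕ Fin s) ℤ) (x : Fin m → k) :
    Subalgebra.center k (invDiffOpsY k L) :=
  ⟨⟨lieOp (weightY L) x, lieOp_mem _ _ x⟩, Subalgebra.mem_center_iff.mpr fun F =>
    Subtype.ext (lieOp_commute (mem_invDiffOpsY_iff.mp F.2).2 x).symm⟩

/-- The monomials in the operators given by a family of elements of the Lie algebra of the torus. -/
def lieMonomial (L : Matrix (Fin m) (Fin r ⊕ Fin s) ℤ) (X : Fin s → Fin m → k) :
    Multiplicative (Fin s →₀ ℕ) →* invDiffOpsY k L :=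
  -- Polynomials are evaluated inside the center, which is commutative.
  (((Subalgebra.center k (invDiffOpsY k L)).val.comp
    (MvPolynomial.aeval fun j => centralLieOp L (X j))) :
      MvPolynomial (Fin s) k →* invDiffOpsY k L).comp (MvPolynomial.monomialOneHom k (Fin s))

theorem lieMonomial_apply (X : Fin s → Fin m → k) (γ : Fin s →₀ ℕ) :
    lieMonomial L X (Multiplicative.ofAdd γ) = ((MvPolynomial.aeval
      (fun j => centralLieOp L (X j)) (MvPolynomial.monomial γ (1 : k)) :
        Subalgebra.center k (invDiffOpsY k L)) : invDiffOpsY k L) := rfl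

theorem lieMonomial_commute (X : Fin s → Fin m → k) (γ : Multiplicative (Fin s →₀ ℕ))
    (F : invDiffOpsY k L) : Commute F (lieMonomial L X γ) :=
  Subalgebra.mem_center_iff.mp (MvPolynomial.aeval
      (fun j => centralLieOp L (X j)) (MvPolynomial.monomial γ.toAdd (1 : k))).2 F

theorem lieMonomial_single_apply (X : Fin s → Fin m → k) (γ : Fin s →₀ ℕ)
    (p : (Fin r → ℕ) × (Fin s → ℤ)) :
    (lieMonomial L X (Multiplicative.ofAdd γ) : Module.End k (FunY k r s))
        (AddMonoidAlgebra.single p 1)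
      = MvPolynomial.eval (fun j => diffCharacter (X j) (weightY L p))
          (MvPolynomial.monomial γ (1 : k)) • AddMonoidAlgebra.single p (1 : k) := by
  let f : MvPolynomial (Fin s) k →ₐ[k] Module.End k (FunY k r s) :=
    (invDiffOpsY k L).val.comp ((Subalgebra.center k (invDiffOpsY k L)).val.comp
      (MvPolynomial.aeval fun j => centralLieOp L (X j)))
  have hf : ∀ j, f (MvPolynomial.X j) = lieOp (weightY L) (X j) := fun j =>
    congrArg (fun F : Subalgebra.center k (invDiffOpsY k L) =>
      ((F : invDiffOpsY k L) : Module.End k (FunY k r s))) (MvPolynomial.aeval_X _ j)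
  suffices ∀ P, f P (AddMonoidAlgebra.single p 1)
      = MvPolynomial.eval (fun j => diffCharacter (X j) (weightY L p)) P
        • AddMonoidAlgebra.single p (1 : k) from this _
  intro P
  induction P using MvPolynomial.induction_on with
  | C a => rw [← MvPolynomial.algebraMap_eq, AlgHom.commutes, Module.algebraMap_end_apply,
      MvPolynomial.algebraMap_eq, MvPolynomial.eval_C]
  | add P Q hP hQ => rw [map_add, map_add, add_smul, ← hP, ← hQ, LinearMap.add_apply]
  | mul_X P j hP => rw [map_mul, map_mul, MvPolynomial.eval_X, hf, Module.End.mul_apply,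
      lieOp_weightY_single, map_smul, hP, smul_smul, mul_comm]

/-- Polynomials with coefficients in the algebra of invariant operators on `V`, evaluated at
commuting operators on `Y` that are given by elements of the Lie algebra of the torus. -/
def polyHom (hL : Function.Injective (weightW L)) (w : Fin s → kˣ) (X : Fin s → Fin m → k) :
    AddMonoidAlgebra (invDiffOpsV L (stabW L w)) (Fin s →₀ ℕ) →ₐ[k] invDiffOpsY k L :=
  AddMonoidAlgebra.liftNCAlgHom (liftHom hL w) (lieMonomial L X)
    fun D γ => lieMonomial_commute X γ (liftHom hL w D)

theorem polyHom_single (hL : Function.Injective (weightW L)) (w : Fin s → kˣ)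
    (X : Fin s → Fin m → k) (γ : Fin s →₀ ℕ) (D : invDiffOpsV L (stabW L w)) :
    polyHom hL w X (AddMonoidAlgebra.single γ D)
      = liftHom hL w D * lieMonomial L X (Multiplicative.ofAdd γ) := by
  rw [polyHom, AddMonoidAlgebra.coe_liftNCAlgHom, AddMonoidAlgebra.liftNC_single]
  rfl

theorem lieMonomial_zero (X : Fin s → Fin m → k) :
    lieMonomial L X (Multiplicative.ofAdd 0) = 1 := by
  rw [ofAdd_zero, map_one]

theorem lieMonomial_one (X : Fin s → Fin m → k) (j : Fin s) :
    (lieMonomial L X (Multiplicative.ofAdd (Finsupp.single j 1)) : Module.End k (FunY k r s))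
      = lieOp (weightY L) (X j) := by
  rw [lieMonomial_apply]
  change ((MvPolynomial.aeval _ (MvPolynomial.X j : MvPolynomial (Fin s) k) :
    Subalgebra.center k (invDiffOpsY k L)) : invDiffOpsY k L).1 = _
  rw [MvPolynomial.aeval_X]
  rfl

theorem restrictV_polyHom (hL : Function.Injective (weightW L)) (w : Fin s → kˣ)
    (X : Fin s → Fin m → k) (z : AddMonoidAlgebra (invDiffOpsV L (stabW L w)) (Fin s →₀ ℕ))
    (α : Fin r → ℕ) (β : Fin s → ℤ) :
    restrictV k r s ((polyHom hL w X z : Module.End k (FunY k r s))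
        (AddMonoidAlgebra.single (α, β) 1))
      = ∑ γ ∈ z.coeff.support, MvPolynomial.eval
          (fun j => diffCharacter (X j) (weightY L (α, β))) (MvPolynomial.monomial γ (1 : k))
          • (z.coeff γ : Module.End k (FunV k r)) (AddMonoidAlgebra.single α 1) := by
  conv_lhs => rw [← z.sum_coeff_single, Finsupp.sum, map_sum]
  rw [AddSubmonoidClass.coe_finsetSum, LinearMap.sum_apply, map_sum]
  refine Finset.sum_congr rfl fun γ _ => ?_
  rw [polyHom_single, MulMemClass.coe_mul, Module.End.mul_apply, lieMonomial_single_apply, map_smul,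
    map_smul, coe_liftHom, restrictV_liftOp_single (mem_invDiffOpsV_iff.mp (z.coeff γ).2).2]

/-- Applied to the monomial with exponents (α, β) and restricted to V, the image of z has as its
coefficients polynomials in the values of the X_j on the weight. As β varies, these values run
independently through translates of ℤ, so the polynomials, and with them the coefficients of z, are
determined. -/
theorem polyHom_injective (hL : Function.Injective (weightW L)) (w : Fin s → kˣ)
    {X : Fin s → Fin m → k} (hX : ∀ j β, diffCharacter (X j) (weightW L β) = β j) :
    Function.Injective (polyHom hL w X) := by
  intro z z' hz
  ext1
  refine Finsupp.ext fun γ => Subtype.ext (linearMap_ext_single fun α => ?_)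
  ext α'
  let P (z : AddMonoidAlgebra (invDiffOpsV L (stabW L w)) (Fin s →₀ ℕ)) : MvPolynomial (Fin s) k :=
    ∑ γ ∈ z.coeff.support, MvPolynomial.monomial γ
      (((z.coeff γ : Module.End k (FunV k r)) (AddMonoidAlgebra.single α 1)).coeff α')
  have hcoeff : ∀ z, (P z).coeff γ
      = ((z.coeff γ : Module.End k (FunV k r)) (AddMonoidAlgebra.single α 1)).coeff α' := by
    classical
    intro z
    simp only [P, MvPolynomial.coeff_sum, MvPolynomial.coeff_monomial, Finset.sum_ite_eq',
      Finsupp.mem_support_iff]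
    split_ifs with h0
    · rfl
    · rw [not_not] at h0
      simp [h0]
  have heval : ∀ z β, MvPolynomial.eval (fun j => diffCharacter (X j) (weightY L (α, β))) (P z)
      = (restrictV k r s ((polyHom hL w X z : Module.End k (FunY k r s))
        (AddMonoidAlgebra.single (α, β) 1))).coeff α' := by
    intro z β
    rw [restrictV_polyHom, map_sum, AddMonoidAlgebra.coeff_sum, Finsupp.finsetSum_apply]
    refine Finset.sum_congr rfl fun δ _ => ?_
    rw [MvPolynomial.eval_monomial, MvPolynomial.eval_monomial, one_mul,
      AddMonoidAlgebra.coeff_smul_apply, smul_eq_mul, mul_comm]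
  have hP : P z = P z' := by
    refine MvPolynomial.funext_set
      (fun j => Set.range fun n : ℤ => diffCharacter (X j) (weightV L α) + (n : k))
      (fun j => Set.infinite_range_of_injective fun a b h => by simpa using h) fun y hy => ?_
    choose β hβ using fun j => hy j trivial
    have hy' : y = fun j => diffCharacter (X j) (weightY L (α, β)) := by
      ext j
      rw [← hβ j, weightY_apply, map_add, hX]
    rw [hy', heval, heval, hz]
  rw [← hcoeff, ← hcoeff, hP]

theorem polyHom_surjective (hL : Function.Injective (weightW L)) (w : Fin s → kˣ)
    {X : Fin s → Fin m → k} (hX : ∀ j β, diffCharacter (X j) (weightW L β) = β j) :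
    Function.Surjective (polyHom hL w X) := by
  intro F
  obtain ⟨z, hz⟩ := invDiffOpsY_le hL w X hX ((invDiffOpsY k L).val.comp (polyHom hL w X)).range
    (fun D hD => ⟨AddMonoidAlgebra.single 0 ⟨D, hD⟩, by
      rw [AlgHom.toRingHom_eq_coe, RingHom.coe_coe, AlgHom.comp_apply, polyHom_single,
        lieMonomial_zero, mul_one]
      rfl⟩)
    (fun j => ⟨AddMonoidAlgebra.single (Finsupp.single j 1) 1, by
      rw [AlgHom.toRingHom_eq_coe, RingHom.coe_coe, AlgHom.comp_apply, polyHom_single, map_one,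
        one_mul]
      exact lieMonomial_one X j⟩) F.2
  exact ⟨z, Subtype.ext hz⟩

/-- The algebra of invariant operators on `Y` retracts onto that on `V`, with prescribed scalar
values at a dual system of the weights of the coordinates of `W`. -/
theorem exists_retraction (hL : Function.Injective (weightW L)) (w : Fin s → kˣ)
    {X : Fin s → Fin m → k} (hX : ∀ j β, diffCharacter (X j) (weightW L β) = β j) (c : Fin s → k) :
    ∃ ε : invDiffOpsY k L →ₐ[k] invDiffOpsV L (stabW L w),
      (∀ D, ε (liftHom hL w D) = D) ∧
      ∀ j, ε ⟨lieOp (weightY L) (X j), lieOp_mem _ _ _⟩ = algebraMap k _ (c j) := by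
  let e := AlgEquiv.ofBijective (polyHom hL w X) ⟨polyHom_injective hL w hX,
    polyHom_surjective hL w hX⟩
  -- Evaluation of the variables at the scalars c_j, which commute with all coefficients.
  let v : AddMonoidAlgebra (invDiffOpsV L (stabW L w)) (Fin s →₀ ℕ) →ₐ[k]
      invDiffOpsV L (stabW L w) :=
    AddMonoidAlgebra.liftNCAlgHom (AlgHom.id k _)
      ((((Algebra.ofId k (invDiffOpsV L (stabW L w))).comp (MvPolynomial.aeval c)) :
        MvPolynomial (Fin s) k →* invDiffOpsV L (stabW L w)).comp
          (MvPolynomial.monomialOneHom k (Fin s)))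
      fun D γ => (Algebra.commutes (MvPolynomial.aeval c (MvPolynomial.monomialOneHom k _ γ)) D).symm
  have hv : ∀ γ D, v (AddMonoidAlgebra.single γ D)
      = D * algebraMap k _ (MvPolynomial.aeval c (MvPolynomial.monomial γ (1 : k))) :=
    fun γ D => AddMonoidAlgebra.liftNC_single _ _ γ D
  have he : ∀ z, e z = polyHom hL w X z := fun _ => rfl
  refine ⟨v.comp e.symm.toAlgHom, fun D => ?_, fun j => ?_⟩
  · have h1 : liftHom hL w D = e (AddMonoidAlgebra.single 0 D) := by
      rw [he, polyHom_single, lieMonomial_zero, mul_one]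
    change v (e.symm _) = _
    rw [h1, AlgEquiv.symm_apply_apply, hv]
    change D * algebraMap k _ (MvPolynomial.aeval c (1 : MvPolynomial (Fin s) k)) = D
    rw [map_one, map_one, mul_one]
  · have h1 : (⟨lieOp (weightY L) (X j), lieOp_mem _ _ _⟩ : invDiffOpsY k L)
        = e (AddMonoidAlgebra.single (Finsupp.single j 1) 1) := by
      rw [he, polyHom_single, map_one, one_mul]
      exact Subtype.ext (lieMonomial_one X j).symm
    change v (e.symm _) = _
    rw [h1, AlgEquiv.symm_apply_apply, hv, one_mul]
    change algebraMap k _ (MvPolynomial.aeval c (MvPolynomial.X j : MvPolynomial (Fin s) k)) = _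
    rw [MvPolynomial.aeval_X]

end Polynomials

/-! ### Comparison of the reductions -/

section Comparison

variable {k : Type*} [Field k] {m r s : ℕ} {M : Type*} [AddCommMonoid M]

/-- The action of the Lie algebra of the torus on `k[M]` as a linear map. -/
def lieOpHom (wt : M →+ (Fin m → ℤ)) (H : Subgroup (Torus k m)) :
    (Fin m → k) →ₗ[k] invDiffOps (torusAct (k := k) wt) H where
  toFun x := ⟨lieOp wt x, lieOp_mem wt H x⟩
  map_add' x y := Subtype.ext (linearMap_ext_single fun α => by
    change lieOp wt (x + y) _ = lieOp wt x _ + lieOp wt y _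
    simp only [lieOp_single, Pi.add_apply, add_mul, Finset.sum_add_distrib,
      AddMonoidAlgebra.single_add, mul_add])
  map_smul' c x := Subtype.ext (linearMap_ext_single fun α => by
    change lieOp wt (c • x) _ = c • lieOp wt x _
    simp only [lieOp_single, Pi.smul_apply, smul_eq_mul, AddMonoidAlgebra.smul_single, mul_assoc,
      Finset.mul_sum, one_mul])

theorem Reduction.mk_lieOpHom (wt : M →+ (Fin m → ℤ)) (H : Subgroup (Torus k m))
    (μ : Module.Dual k (lieAlg H)) (x : lieAlg H) :
    Reduction.mk wt H μ (lieOpHom wt H x) = algebraMap k _ (μ x) := by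
  rw [← AlgHom.commutes (Reduction.mk wt H μ)]
  exact RingQuot.mkAlgHom_rel k ⟨x, rfl, rfl⟩

theorem Reduction.exists_lift {C : Type*} [Semiring C] [Algebra k C] (wt : M →+ (Fin m → ℤ))
    (H : Subgroup (Torus k m)) (μ : Module.Dual k (lieAlg H))
    (f : invDiffOps (torusAct (k := k) wt) H →ₐ[k] C)
    (hf : ∀ x : lieAlg H, f (lieOpHom wt H x) = algebraMap k C (μ x)) :
    ∃ F : Reduction wt H μ →ₐ[k] C, ∀ D, F (Reduction.mk wt H μ D) = f D := by
  refine ⟨RingQuot.liftAlgHom k ⟨f, ?_⟩, fun D => RingQuot.liftAlgHom_mkAlgHom_apply k f _ D⟩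
  rintro a b ⟨x, rfl, rfl⟩
  rw [AlgHom.commutes]
  exact hf x

variable {L : Matrix (Fin m) (Fin r ⊕ Fin s) ℤ}

/-- Such an x does not see the W-part of a weight, so its eigenvalue on a monomial of Y is the one
on the V-part. -/
theorem liftOp_lieOp (hL : Function.Injective (weightW L)) {x : Fin m → k}
    (hx : ∀ β, diffCharacter x (weightW L β) = 0) :
    liftOp L 0 (lieOp (weightV L) x) = lieOp (weightY L) x := by
  refine linearMap_ext_single fun p => ?_
  obtain ⟨α, β⟩ := p
  rw [liftOp_single, lieOp_single, liftToWeight_single hL (add_zero _).symm, lieOp_weightY_single,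
    weightY_apply, map_add, hx, add_zero, AddMonoidAlgebra.smul_single, smul_eq_mul, mul_comm]
  rfl

variable [IsAlgClosed k] [CharZero k]

theorem liftHom_lieOpHom (hL : Function.Injective (weightW L)) (w : Fin s → kˣ)
    (x : lieAlg (stabW L w)) :
    liftHom hL w (lieOpHom (weightV L) (stabW L w) x) = lieOpHom (weightY L) ⊤ x :=
  Subtype.ext (liftOp_lieOp hL (mem_lieAlg_stabW.mp x.2))

/-- The inverse is induced by the retraction sending X_j to λ(X_j), the value that the relations on
Y force. -/
theorem exists_reduction_equiv (hL : Function.Injective (weightW L)) (w : Fin s → kˣ)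
    (lam : Module.Dual k (lieAlg (⊤ : Subgroup (Torus k m)))) :
    ∃ e : Reduction (weightV L) (stabW L w) (restrictDual (stabW L w) lam) ≃ₐ[k]
        Reduction (weightY L) (⊤ : Subgroup (Torus k m)) lam,
      ∀ D : invDiffOpsV L (stabW L w),
        e (Reduction.mk (weightV L) (stabW L w) (restrictDual (stabW L w) lam) D) =
          Reduction.mk (weightY L) (⊤ : Subgroup (Torus k m)) lam (liftHom hL w D) := by
  set H := stabW L w
  obtain ⟨X, hX'⟩ := exists_dual_weights (k := k) hL
  have hX : ∀ j β, diffCharacter (X j) (weightW L β) = β j := hX'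
  let c : Fin s → k := fun j => lam ⟨X j, mem_lieAlg_top _⟩
  obtain ⟨ε, hε, hεX⟩ := exists_retraction hL w hX c
  obtain ⟨f, hf⟩ := Reduction.exists_lift (weightV L) H (restrictDual H lam)
    ((Reduction.mk (weightY L) ⊤ lam).comp (liftHom hL w)) fun x => by
      rw [AlgHom.comp_apply, liftHom_lieOpHom]
      exact Reduction.mk_lieOpHom (weightY L) ⊤ lam (Submodule.inclusion (lieAlg_mono le_top) x)
  obtain ⟨g, hg⟩ := Reduction.exists_lift (weightY L) ⊤ lam
    ((Reduction.mk (weightV L) H (restrictDual H lam)).comp ε) fun x => by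
      -- Decomposition of x along 𝔤 = 𝔥 ⊕ ⟨X_j⟩: duality gives the coefficients a_j, and y is the
      -- component in 𝔥.
      let a : Fin s → k := fun j => diffCharacter (x : Fin m → k) (weightW L (Pi.single j 1))
      let y : Fin m → k := (x : Fin m → k) - ∑ j, a j • X j
      have hy : y ∈ lieAlg H := mem_lieAlg_stabW.mpr fun β => by
        have h1 : diffCharacter y (weightW L β) = diffCharacter (x : Fin m → k) (weightW L β)
            - ∑ j, a j * diffCharacter (X j) (weightW L β) := by
          simp only [y, diffCharacter_apply, Pi.sub_apply, Finset.sum_apply, Pi.smul_apply,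
            smul_eq_mul, sub_mul, Finset.sum_sub_distrib, Finset.sum_mul, Finset.mul_sum, mul_assoc]
          rw [Finset.sum_comm]
        have h2 : diffCharacter (x : Fin m → k) (weightW L β) = ∑ j, a j * β j := by
          conv_lhs => rw [pi_eq_sum_univ' β, map_sum, map_sum]
          refine Finset.sum_congr rfl fun j _ => ?_
          rw [map_zsmul, map_zsmul, zsmul_eq_mul, mul_comm]
        simp only [h1, h2, hX, sub_self]
      have hxy : x = Submodule.inclusion (lieAlg_mono le_top) (⟨y, hy⟩ : lieAlg H)
          + ∑ j, a j • (⟨X j, mem_lieAlg_top _⟩ : lieAlg (⊤ : Subgroup (Torus k m))) := by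
        refine Subtype.ext ?_
        simp [y]
      have hx : (x : Fin m → k) = y + ∑ j, a j • X j := by simp [y]
      have hεy : ε (lieOpHom (weightY L) ⊤ y) = lieOpHom (weightV L) H y := by
        rw [← hε (lieOpHom (weightV L) H y)]
        exact congrArg ε (liftHom_lieOpHom hL w ⟨y, hy⟩).symm
      have hεX' : ∀ j, ε (lieOpHom (weightY L) ⊤ (X j)) = algebraMap k _ (c j) := hεX
      have h3 := Reduction.mk_lieOpHom (weightV L) H (restrictDual H lam) ⟨y, hy⟩
      have h4 : lam x = restrictDual H lam ⟨y, hy⟩ + ∑ j, a j * c j := by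
        conv_lhs => rw [hxy, map_add, map_sum]
        simp only [map_smul, smul_eq_mul]
        rfl
      rw [AlgHom.comp_apply, h4, hx, map_add, map_add, map_add, hεy, map_add, h3, map_sum, map_sum,
        map_sum, map_sum]
      congr 1
      refine Finset.sum_congr rfl fun j _ => ?_
      rw [map_smul, map_smul, hεX', map_smul, AlgHom.commutes, map_mul, Algebra.smul_def]
  -- Both sides are algebra homomorphisms in F, so it is enough to compare them on the lifts and on
  -- the X_j, which generate.
  have hfg : ∀ F, Reduction.mk (weightY L) ⊤ lam (liftHom hL w (ε F))
      = Reduction.mk (weightY L) ⊤ lam F := by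
    let A : Subalgebra k (invDiffOpsY k L) := AlgHom.equalizer
      ((Reduction.mk (weightY L) ⊤ lam).comp ((liftHom hL w).comp ε))
      (Reduction.mk (weightY L) ⊤ lam)
    have hA : invDiffOpsY k L ≤ A.map (invDiffOpsY k L).val :=
      invDiffOpsY_le hL w X hX _
        (fun D hD => ⟨liftHom hL w ⟨D, hD⟩, by
          change Reduction.mk (weightY L) ⊤ lam (liftHom hL w (ε (liftHom hL w ⟨D, hD⟩))) = _
          rw [hε], rfl⟩)
        (fun j => ⟨lieOpHom (weightY L) ⊤ (X j), by
          change Reduction.mk (weightY L) ⊤ lam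
            (liftHom hL w (ε (lieOpHom (weightY L) ⊤ (X j)))) = _
          have hεX' : ε (lieOpHom (weightY L) ⊤ (X j)) = algebraMap k _ (c j) := hεX j
          rw [hεX', AlgHom.commutes, AlgHom.commutes]
          exact (Reduction.mk_lieOpHom (weightY L) ⊤ lam ⟨X j, mem_lieAlg_top _⟩).symm, rfl⟩)
    intro F
    obtain ⟨F', hF', hFF'⟩ := hA F.2
    have : F' = F := Subtype.ext hFF'
    rw [← this]
    exact hF'
  refine ⟨AlgEquiv.ofAlgHom f g ?_ ?_, hf⟩
  · refine AlgHom.ext fun z => ?_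
    obtain ⟨F, rfl⟩ := RingQuot.mkAlgHom_surjective k _ z
    change f (g (Reduction.mk (weightY L) ⊤ lam F)) = Reduction.mk (weightY L) ⊤ lam F
    rw [hg, AlgHom.comp_apply, hf, AlgHom.comp_apply, hfg]
  · refine AlgHom.ext fun z => ?_
    obtain ⟨D, rfl⟩ := RingQuot.mkAlgHom_surjective k _ z
    change g (f (Reduction.mk (weightV L) H (restrictDual H lam) D)) = Reduction.mk _ _ _ D
    rw [hf, AlgHom.comp_apply, hg, AlgHom.comp_apply, hε]

end Comparison

end

end TorusDiffOps

open TorusDiffOps in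
theorem propositionC {k : Type*} [Field k] [IsAlgClosed k] [CharZero k] {m r s : ℕ}
    (L : Matrix (Fin m) (Fin r ⊕ Fin s) ℤ) (hL : IsTransitiveOnW k L) (w : Fin s → kˣ) :
    ∃ ξ : invDiffOpsV L (stabW L w) →ₐ[k] invDiffOpsY k L,
      Function.Injective ξ ∧
      ∀ lam : Module.Dual k (lieAlg (⊤ : Subgroup (Torus k m))),
        ∃ e : Reduction (weightV L) (stabW L w) (restrictDual (stabW L w) lam) ≃ₐ[k]
            Reduction (weightY L) (⊤ : Subgroup (Torus k m)) lam,
          ∀ D : invDiffOpsV L (stabW L w),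
            e (Reduction.mk (weightV L) (stabW L w) (restrictDual (stabW L w) lam) D) =
              Reduction.mk (weightY L) (⊤ : Subgroup (Torus k m)) lam (ξ D) := by
  exact ⟨liftHom (weightW_injective hL) w, liftHom_injective (weightW_injective hL) w,
    fun lam => exists_reduction_equiv (weightW_injective hL) w lam⟩
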